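/- Let $K$ be a field and let $\Lambda = K\Gamma/I$ be a split finite-dimensional $K$-algebra, where $\Gamma$ is a finite quiver and $I$ is an admissible ideal of the path algebra $K\Gamma$; let $J$ be the Jacobson radical of $\Lambda$. Products of paths are read from right to left, and a path $u$ is a right subpath of $p$ if $p = vu$ for some path $v$. Modules are left modules. A mast of a uniserial $\Lambda$-module $U$ of length $l+1$ is a path $p$ of length $l$ with $pU \neq 0$; a top element of a module $M$ is an element $x \in M\setminus JM$ with $x = ex$ for some vertex $e$ of $\Gamma$. For a path $p$ in $\Gamma$, let $V_p$ be the affine variety (set of $K$-points) of all tuples $k = (k(\alpha u, s))$ in $K$, where $u$ and $s$ are right subpaths of $p$ and $\alpha$ is an arrow that can be composed with $u$ such that $\alpha u$ is not a right subpath of $p$, $s$ is longer than $u$, and $s$ ends where $\alpha$ ends, with the following property: the $K\Gamma$-module $M_p(k)$ with $K$-basis $(b_u)$ indexed by the right subpaths $u$ of $p$, on which a vertex $e$ acts as the projection onto the span of those $b_u$ for which $u$ ends in $e$, and on which an arrow $\alpha$ acts by $\alpha b_u = b_{\alpha u}$ if $\alpha u$ is a right subpath of $p$, $\alpha b_u =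 \sum_s k(\alpha u, s)\, b_s$ for all other arrows $\alpha$ starting where $u$ ends, and $\alpha b_u = 0$ for the remaining arrows, is annihilated by $I$. (The modules $M_p(k)$, $k \in V_p$, are up to isomorphism the uniserial $\Lambda$-modules with mast $p$.) All graphs of uniserial $\Lambda$-modules are said to be edge paths if, for every uniserial $\Lambda$-module $U$, every mast $p$ of $U$ and every top element $x$ of $U$ with $x = ex$ for the starting vertex $e$ of $p$, each path $q$ that starts in $e$ and is not a right subpath of $p$ satisfies $qx = 0$. A saguaro is a $\Lambda$-module isomorphic to $\bigl(\bigoplus_{i=1}^m T_i\bigr)/U$, where $m \ge 1$, each $T_i$ is a nonzero uniserial $\Lambda$-module of finite length with mast $p_i$, the submodule $U \subseteq \bigoplus_{i=1}^m JT_i$ is generated by elements $q_i t_i - q_{i+1}' t_{i+1}$ $(1 \le i \le m-1)$, where the $t_i \in T_i$ are top elements and $q_i, q_i'$ are right subpaths of $p_i$ with $q_i t_i \ne 0$ and $q'_{i+1} t_{i+1} \neq 0$, and each canonical map $T_j \to \bigl(\bigoplus_i T_i\bigr)/U$ is injective. Let $\mathcal S$ (respectively $\mathcal S^\infty$) be the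 full subcategory of the category $\Lambda\text{-mod}$ of finitely generated $\Lambda$-modules whose objects are all finite direct sums of saguaros (respectively, of saguaros of finite projective dimension). Theorem. Suppose that $K$ is infinite and $V_p$ is finite for every path $p$ in $\Gamma$, or that ($K$ being arbitrary) all graphs of uniserial $\Lambda$-modules are edge paths. Then $\mathcal S$ and $\mathcal S^\infty$ have finite representation type: each of them contains finitely many objects $A_1, \dots, A_n$ such that every object of the subcategory is isomorphic to a finite direct sum of copies of the $A_i$. Hence both are contravariantly finite in $\Lambda\text{-mod}$: every finitely generated $\Lambda$-module $M$ has a right approximation, that is, a homomorphism $f : A \to M$ with $A$ in the subcategory such that every homomorphism $B \to M$ with $B$ in the subcategory factors through $f$. -/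

import Mathlib

open CategoryTheory

universe u v w x

noncomputable section

/-- A path of the quiver `V`, bundled with its starting point and its end point. -/
structure QPath (V : Type u) [Quiver.{v} V] where
  src : V
  tgt : V
  path : Quiver.Path src tgt

namespace QPath

variable {V : Type u} [Quiver.{v} V]

/-- The length of a path (the number of its arrows). -/
def length (p : QPath V) : ℕ := p.path.length

/-- The trivial path at a vertex. -/
def triv (a : V) : QPath V := ⟨a, a, Quiver.Path.nil⟩

/-- The path `α u` (first `u`, then the arrow `α`). -/
def cons (u : QPath V) {d : V} (α : u.tgt ⟶ d) : QPath V := ⟨u.src, d, u.path.cons α⟩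

/-- `u` is a right subpath of `p`: there is a path `y` with `p = y u` (first `u`, then `y`).
Mathlib's `Quiver.Path.comp` composes in the order in which the paths are walked. -/
def IsRightSubpath (u p : QPath V) : Prop :=
  ∃ (a b c : V) (x : Quiver.Path a b) (y : Quiver.Path b c),
    u = ⟨a, b, x⟩ ∧ p = ⟨a, c, x.comp y⟩

/-- The right subpaths of `p`; there are `p.length + 1` of them. -/
abbrev RightSubpath (p : QPath V) : Type (max u v) := {u : QPath V // IsRightSubpath u p}

theorem comp_left_unique {a c : V} : ∀ {b b' : V} (x : Quiver.Path a b) (y : Quiver.Path b c)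
    (x' : Quiver.Path a b') (y' : Quiver.Path b' c), x.comp y = x'.comp y' →
    x.length = x'.length → (⟨a, b, x⟩ : QPath V) = ⟨a, b', x'⟩ := by
  intro b b' x y
  induction y with
  | nil =>
    intro x' y' h hl
    cases y' with
    | nil => simp at h; subst h; rfl
    | cons y' e =>
      exfalso
      have := congrArg Quiver.Path.length h
      simp at this
      omega
  | cons y e ih =>
    intro x' y' h hl
    cases y' with
    | nil =>
      exfalso
      have := congrArg Quiver.Path.length h
      simp at this
      omega
    | cons y' e' =>
      simp only [Quiver.Path.comp_cons] at h
      have hobj := Quiver.Path.obj_eq_of_cons_eq_cons h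
      subst hobj
      have h2 := eq_of_heq (Quiver.Path.heq_of_cons_eq_cons h)
      exact ih x' y' h2 hl

instance (p : QPath V) : Finite (RightSubpath p) := by
  have hle : ∀ u : RightSubpath p, u.1.length < p.length + 1 := by
    rintro ⟨u, a, b, c, x, y, rfl, rfl⟩
    simp [length]
  refine Finite.of_injective
    (fun u : RightSubpath p => (⟨u.1.length, hle u⟩ : Fin (p.length + 1))) ?_
  rintro ⟨u, hu⟩ ⟨u', hu'⟩ h
  obtain ⟨a, b, c, x, y, rfl, rfl⟩ := hu
  obtain ⟨a', b', c', x', y', rfl, h'⟩ := hu'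
  injection h' with h1 h2 h3
  subst h1
  subst h2
  have hl : x.length = x'.length := by simpa [length] using h
  exact Subtype.ext (comp_left_unique x y x' y' (eq_of_heq h3) hl)

instance (p : QPath V) : Fintype (RightSubpath p) := Fintype.ofFinite _

end QPath

/-- The path algebra `KΓ` of a quiver: formal linear combinations of paths. -/
def PathAlgebra (K : Type w) (V : Type u) [Quiver.{v} V] [Field K] : Type (max u v w) :=
  QPath V →₀ K

namespace PathAlgebra

variable {K : Type w} [Field K] {V : Type u} [Quiver.{v} V]

instance : AddCommGroup (PathAlgebra K V) := inferInstanceAs (AddCommGroup (QPath V →₀ K))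

instance : Module K (PathAlgebra K V) := inferInstanceAs (Module K (QPath V →₀ K))

/-- A path as an element of the path algebra. -/
def ofPath (p : QPath V) : PathAlgebra K V := Finsupp.single p 1

open Classical in
/-- The product `p q` of two paths is "`p` after `q`" if `q` ends where `p` starts, and is zero
otherwise. -/
def mulPath (p q : QPath V) : PathAlgebra K V :=
  if h : q.tgt = p.src then ofPath ⟨q.src, p.tgt, q.path.comp (p.path.cast h.symm rfl)⟩ else 0

/-- The bilinear extension of the product of paths. -/
def mulHom : PathAlgebra K V →ₗ[K] PathAlgebra K V →ₗ[K] PathAlgebra K V :=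
  Finsupp.linearCombination K fun p : QPath V =>
    (Finsupp.linearCombination K fun q : QPath V => (mulPath p q : PathAlgebra K V) :
      (QPath V →₀ K) →ₗ[K] PathAlgebra K V)

instance : Mul (PathAlgebra K V) := ⟨fun x y => mulHom x y⟩

theorem mul_def (x y : PathAlgebra K V) : x * y = mulHom x y := rfl

theorem mulHom_ofPath (p q : QPath V) :
    mulHom (ofPath p : PathAlgebra K V) (ofPath q) = mulPath p q := by
  simp only [mulHom, ofPath]
  erw [Finsupp.linearCombination_single, one_smul, Finsupp.linearCombination_single, one_smul]

theorem ofPath_mul_ofPath (p q : QPath V) :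
    (ofPath p : PathAlgebra K V) * ofPath q = mulPath p q := mulHom_ofPath p q

theorem mulPath_of_eq {a b c : V} (y : Quiver.Path b c) (x : Quiver.Path a b) :
    (mulPath ⟨b, c, y⟩ ⟨a, b, x⟩ : PathAlgebra K V) = ofPath ⟨a, c, x.comp y⟩ := by
  simp [mulPath]

theorem mulPath_of_ne {p q : QPath V} (h : q.tgt ≠ p.src) :
    (mulPath p q : PathAlgebra K V) = 0 := by
  simp [mulPath, h]

theorem induction_ofPath {P : PathAlgebra K V → Prop} (x : PathAlgebra K V) (h0 : P 0)
    (hadd : ∀ x y, P x → P y → P (x + y)) (hpath : ∀ (c : K) p, P (c • ofPath p)) : P x := by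
  refine Finsupp.induction_linear (motive := fun z : QPath V →₀ K => P z) x h0
    (fun f g hf hg => hadd f g hf hg) (fun p c => ?_)
  have h := hpath c p
  have e : (c • ofPath p : PathAlgebra K V) = (Finsupp.single p c : QPath V →₀ K) := by
    simp only [ofPath]
    erw [Finsupp.smul_single, smul_eq_mul, mul_one]
  rwa [e] at h

theorem mulPath_assoc (p q r : QPath V) :
    mulHom (mulPath p q : PathAlgebra K V) (ofPath r) = mulHom (ofPath p) (mulPath q r) := by
  obtain ⟨a, b, p⟩ := p
  obtain ⟨c, d, q⟩ := q
  obtain ⟨e, f, r⟩ := r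
  by_cases h1 : d = a
  · subst h1
    by_cases h2 : f = c
    · subst h2
      simp [mulPath_of_eq, mulHom_ofPath]
    · rw [mulPath_of_eq, mulHom_ofPath, mulPath_of_ne (by simpa using h2),
        mulPath_of_ne (by simpa using h2), map_zero]
  · rw [mulPath_of_ne (by simpa using h1), map_zero, LinearMap.zero_apply]
    by_cases h2 : f = c
    · subst h2
      rw [mulPath_of_eq, mulHom_ofPath, mulPath_of_ne (by simpa using h1)]
    · rw [mulPath_of_ne (by simpa using h2), map_zero]

protected theorem mul_assoc' (x y z : PathAlgebra K V) : x * y * z = x * (y * z) := by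
  simp only [mul_def]
  induction x using induction_ofPath with
  | h0 => simp
  | hadd x x' hx hx' => simp only [map_add, LinearMap.add_apply, hx, hx']
  | hpath c p =>
    simp only [map_smul, LinearMap.smul_apply]
    congr 1
    induction y using induction_ofPath with
    | h0 => simp
    | hadd x x' hx hx' => simp only [map_add, LinearMap.add_apply, hx, hx']
    | hpath c q =>
      simp only [map_smul, LinearMap.smul_apply]
      congr 1
      induction z using induction_ofPath with
      | h0 => simp
      | hadd x x' hx hx' => simp only [map_add, hx, hx']
      | hpath c r =>
        simp only [map_smul]
        congr 1
        rw [mulHom_ofPath, mulHom_ofPath, mulPath_assoc]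

variable [Fintype V]

/-- The unit of the path algebra is the sum of the trivial paths. -/
instance : One (PathAlgebra K V) := ⟨∑ a : V, ofPath (QPath.triv a)⟩

theorem one_def : (1 : PathAlgebra K V) = ∑ a : V, ofPath (QPath.triv a) := rfl

protected theorem one_mul' (x : PathAlgebra K V) : 1 * x = x := by
  simp only [mul_def]
  induction x using induction_ofPath with
  | h0 => simp
  | hadd x x' hx hx' => simp only [map_add, hx, hx']
  | hpath c q =>
    simp only [map_smul]
    congr 1
    rw [one_def, map_sum, LinearMap.sum_apply, Finset.sum_eq_single q.tgt]
    · rw [mulHom_ofPath]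
      simp [mulPath, QPath.triv]
    · intro b _ hb
      rw [mulHom_ofPath, mulPath_of_ne]
      exact fun h => hb h.symm
    · simp

protected theorem mul_one' (x : PathAlgebra K V) : x * 1 = x := by
  simp only [mul_def]
  induction x using induction_ofPath with
  | h0 => simp
  | hadd x x' hx hx' => simp only [map_add, LinearMap.add_apply, hx, hx']
  | hpath c q =>
    simp only [map_smul, LinearMap.smul_apply]
    congr 1
    rw [one_def, map_sum, Finset.sum_eq_single q.src]
    · rw [mulHom_ofPath]
      obtain ⟨a, b, q⟩ := q
      simp [mulPath_of_eq, QPath.triv]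
    · intro b _ hb
      rw [mulHom_ofPath, mulPath_of_ne]
      exact fun h => hb h
    · simp

instance : Ring (PathAlgebra K V) :=
  { (inferInstance : AddCommGroup (PathAlgebra K V)),
    (inferInstance : Mul (PathAlgebra K V)),
    (inferInstance : One (PathAlgebra K V)) with
    left_distrib := fun x y z => by simp only [mul_def, map_add]
    right_distrib := fun x y z => by simp only [mul_def, map_add, LinearMap.add_apply]
    zero_mul := fun x => by simp only [mul_def, map_zero, LinearMap.zero_apply]
    mul_zero := fun x => by simp only [mul_def, map_zero]
    mul_assoc := PathAlgebra.mul_assoc'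
    one_mul := PathAlgebra.one_mul'
    mul_one := PathAlgebra.mul_one' }

instance : Algebra K (PathAlgebra K V) :=
  Algebra.ofModule
    (fun r x y => by simp only [mul_def, map_smul, LinearMap.smul_apply])
    (fun r x y => by simp only [mul_def, map_smul])

end PathAlgebra

/-- A presentation `Λ = KΓ/I` of the algebra `Λ` by a quiver `Γ` (with vertex set `V`) and an
admissible ideal `I`. The ideal `I` is the kernel of `toAlgHom`; it lies in the square of the
arrow ideal (the elements of `KΓ` supported on paths of length at least two) and contains a power
of the arrow ideal (all paths of length at least some `N`). -/
structure SplitPresentation (K : Type w) (V : Type u) (Λ : Type x) [Field K] [Quiver.{v} V]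
    [Fintype V] [Ring Λ] [Algebra K Λ] where
  toAlgHom : PathAlgebra K V →ₐ[K] Λ
  surjective : Function.Surjective toAlgHom
  ker_le : ∀ z : PathAlgebra K V, toAlgHom z = 0 →
    ∀ p ∈ Finsupp.support (z : QPath V →₀ K), 2 ≤ p.length
  exists_pow_le : ∃ N : ℕ, ∀ p : QPath V, N ≤ p.length → toAlgHom (PathAlgebra.ofPath p) = 0

namespace QPath

variable {V : Type u} [Quiver.{v} V]

/-- `IsDetour p q s`: the path `q = α u` consists of a right subpath `u` of `p` and an arrow `α`,
it is not a right subpath of `p`, and `s` is a right subpath of `p` which is longer than `u` and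
has the same end point as `α`. -/
def IsDetour (p q s : QPath V) : Prop :=
  (∃ (u : QPath V) (d : V) (α : u.tgt ⟶ d), IsRightSubpath u p ∧ q = u.cons α) ∧
    ¬ IsRightSubpath q p ∧ IsRightSubpath s p ∧ s.tgt = q.tgt ∧ q.length ≤ s.length

/-- The index set of the coordinates of the affine space which contains `V_p`. -/
abbrev DetourIndex (p : QPath V) : Type (max u v) :=
  {d : QPath V × QPath V // IsDetour p d.1 d.2}

variable {K : Type w} [Field K]

open Classical in
/-- The coordinate at the right subpath `s` of the image of the basis vector `b_u` under the last
arrow of `q = α u`: it is `b_q` if `q` is a right subpath of `p`, and `∑ k(q, s) b_s` otherwise. -/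
def stepEntry (p : QPath V) (k : DetourIndex p → K) (q s : QPath V) : K :=
  if IsRightSubpath q p then (if s = q then 1 else 0)
  else if h : IsDetour p q s then k ⟨(q, s), h⟩ else 0

open Classical in
/-- The action of an arrow on the vector space `M_p(k)` with basis the right subpaths of `p`. -/
def arrowMatrix (p : QPath V) (k : DetourIndex p → K) {c d : V} (α : c ⟶ d) :
    Matrix (RightSubpath p) (RightSubpath p) K :=
  Matrix.of fun s u =>
    if h : c = u.1.tgt then stepEntry p k (u.1.cons (α.cast h rfl)) s.1 else 0

open Classical in
/-- The action of a path on `M_p(k)`; a trivial path acts as the projection to the basis vectors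
that sit at its vertex. -/
def pathMatrix (p : QPath V) (k : DetourIndex p → K) {a : V} :
    ∀ {b : V}, Quiver.Path a b → Matrix (RightSubpath p) (RightSubpath p) K
  | _, Quiver.Path.nil => Matrix.diagonal fun u => if u.1.tgt = a then 1 else 0
  | _, Quiver.Path.cons q α => arrowMatrix p k α * pathMatrix p k q

/-- The action of an element of the path algebra on `M_p(k)`. -/
def algebraMatrix (p : QPath V) (k : DetourIndex p → K) (z : PathAlgebra K V) :
    Matrix (RightSubpath p) (RightSubpath p) K :=
  Finsupp.sum (z : QPath V →₀ K) fun q c => c • pathMatrix p k q.path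

end QPath

/-- A module of finite length is uniserial if it is nonzero and its submodules form a chain. -/
def IsUniserial (Λ : Type x) [Ring Λ] (U : Type x) [AddCommGroup U] [Module Λ U] : Prop :=
  IsFiniteLength Λ U ∧ Nontrivial U ∧ ∀ A B : Submodule Λ U, A ≤ B ∨ B ≤ A

/-- The submodule `JM`, where `J` is the Jacobson radical of `Λ`. -/
def radicalSubmodule (Λ : Type x) [Ring Λ] (M : Type x) [AddCommGroup M] [Module Λ M] :
    Submodule Λ M :=
  Ring.jacobson Λ • (⊤ : Submodule Λ M)

namespace SplitPresentation

variable {K : Type w} [Field K] {V : Type u} [Quiver.{v} V] [Fintype V] {Λ : Type x} [Ring Λ]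
  [Algebra K Λ] (π : SplitPresentation K V Λ)

/-- The residue class in `Λ` of a path. -/
def path (p : QPath V) : Λ := π.toAlgHom (PathAlgebra.ofPath p)

/-- The variety `V_p` of the uniserial modules with mast `p`, as a subset of affine space over
`K`. A point `k` belongs to it when the polynomial equations expressing that `I` annihilates
`M_p(k)` hold. The points `k` of `V_p` are exactly the coordinate strings of uniserial modules `U`
with mast `p`, relative to a top element `x`: for a right subpath `u` of `p` and an arrow `α` such
that `α u` is not a right subpath of `p`, the element `α u x` is `∑ k(α u, s) s x`. -/
def uniserialVariety (p : QPath V) : Set (QPath.DetourIndex p → K) :=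
  {k | ∀ z : PathAlgebra K V, π.toAlgHom z = 0 → QPath.algebraMatrix p k z = 0}

/-- `p` is a mast of the uniserial module `U`: if `U` has length `l + 1`, then `p` has length `l`
and `p U ≠ 0`. -/
def IsMast (p : QPath V) (U : Type x) [AddCommGroup U] [Module Λ U] : Prop :=
  Module.length Λ U = (p.length : ℕ∞) + 1 ∧ ∃ y : U, π.path p • y ≠ 0

/-- `y` is a top element of type `a` of `M`: `y = e_a y` lies outside `JM`. -/
def IsTopElementOfType (a : V) {M : Type x} [AddCommGroup M] [Module Λ M] (y : M) : Prop :=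
  y ∉ radicalSubmodule Λ M ∧ π.path (QPath.triv a) • y = y

/-- `y` is a top element of `M`. -/
def IsTopElement {M : Type x} [AddCommGroup M] [Module Λ M] (y : M) : Prop :=
  ∃ a : V, π.IsTopElementOfType a y

/-- All graphs of uniserial modules are edge paths: for each uniserial module `U` with mast `p` and
each top element `y` of `U`, the graph of `U` relative to `y` records no path other than the right
subpaths of `p`, that is, `q y = 0` for every other path `q` that starts where `p` starts. -/
def UniserialGraphsAreEdgePaths : Prop :=
  ∀ (U : ModuleCat.{x} Λ) (p : QPath V) (y : U), IsUniserial Λ U → π.IsMast p U →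
    π.IsTopElementOfType p.src y → ∀ q : QPath V, q.src = p.src → ¬ QPath.IsRightSubpath q p →
      π.path q • y = 0

/-- `M` is a saguaro on the sequence `T 0, …, T m` of uniserial modules, the trunks. -/
def IsSaguaroOn {m : ℕ} (T : Fin (m + 1) → ModuleCat.{x} Λ) (M : ModuleCat.{x} Λ) : Prop :=
  ∃ (p : Fin (m + 1) → QPath V) (t : ∀ i, T i) (q q' : Fin m → QPath V)
    (U : Submodule Λ (∀ i, T i)),
    (∀ i, IsUniserial Λ (T i) ∧ π.IsMast (p i) (T i) ∧ π.IsTopElement (t i)) ∧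
    (∀ i, QPath.IsRightSubpath (q i) (p i.castSucc) ∧ π.path (q i) • t i.castSucc ≠ 0) ∧
    (∀ i, QPath.IsRightSubpath (q' i) (p i.succ) ∧ π.path (q' i) • t i.succ ≠ 0) ∧
    U = Submodule.span Λ (Set.range fun i : Fin m =>
      (Pi.single i.castSucc (π.path (q i) • t i.castSucc) -
        Pi.single i.succ (π.path (q' i) • t i.succ) : ∀ i, T i)) ∧
    U ≤ Submodule.pi Set.univ (fun i => radicalSubmodule Λ (T i)) ∧
    (∀ j, Function.Injective (U.mkQ ∘ₗ LinearMap.single Λ (fun i => T i) j)) ∧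
    Nonempty (M ≃ₗ[Λ] (∀ i, T i) ⧸ U)

/-- `M` is a saguaro. -/
def IsSaguaro : ObjectProperty (ModuleCat.{x} Λ) := fun M =>
  ∃ (m : ℕ) (T : Fin (m + 1) → ModuleCat.{x} Λ), π.IsSaguaroOn T M

end SplitPresentation

section Subcategories

variable {Λ : Type x} [Ring Λ]

/-- The full subcategory of all finite direct sums of modules in `P`. -/
def finiteDirectSums (P : ObjectProperty (ModuleCat.{x} Λ)) : ObjectProperty (ModuleCat.{x} Λ) :=
  fun M => ∃ (n : ℕ) (N : Fin n → ModuleCat.{x} Λ),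
    (∀ i, P (N i)) ∧ Nonempty (M ≃ₗ[Λ] ∀ i, N i)

/-- Finite projective dimension. -/
def HasFiniteProjectiveDimension : ObjectProperty (ModuleCat.{x} Λ) := fun M =>
  ∃ n : ℕ, HasProjectiveDimensionLT M n

/-- The full subcategory `A` has finite representation type: there are finitely many objects
`N 0, …, N (n - 1)` of `A` such that each object of `A` is a finite direct sum of copies of
these. -/
def HasFiniteRepresentationType (A : ObjectProperty (ModuleCat.{x} Λ)) : Prop :=
  ∃ (n : ℕ) (N : Fin n → ModuleCat.{x} Λ), (∀ i, A (N i)) ∧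
    ∀ M, A M → ∃ (k : ℕ) (c : Fin k → Fin n), Nonempty (M ≃ₗ[Λ] ∀ i, N (c i))

/-- `f : X ⟶ M` is a right `A`-approximation of `M`. -/
def IsRightApproximation (A : ObjectProperty (ModuleCat.{x} Λ)) {X M : ModuleCat.{x} Λ}
    (f : X ⟶ M) : Prop :=
  A X ∧ ∀ (Y : ModuleCat.{x} Λ), A Y → ∀ g : Y ⟶ M, ∃ h : Y ⟶ X, h ≫ f = g

/-- `A` is contravariantly finite in the category of finitely generated `Λ`-modules: its objects
are finitely generated and each finitely generated module has a right `A`-approximation. -/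
def IsContravariantlyFinite (A : ObjectProperty (ModuleCat.{x} Λ)) : Prop :=
  (∀ X, A X → Module.Finite Λ X) ∧
    ∀ M : ModuleCat.{x} Λ, Module.Finite Λ M →
      ∃ (X : ModuleCat.{x} Λ) (f : X ⟶ M), IsRightApproximation A f

end Subcategories

namespace SplitPresentation

variable {K : Type w} [Field K] {V : Type u} [Quiver.{v} V] [Fintype V] {Λ : Type x} [Ring Λ]
  [Algebra K Λ] (π : SplitPresentation K V Λ)

/-- The category `𝒮` of finite direct sums of saguaros. -/
def saguaroCat : ObjectProperty (ModuleCat.{x} Λ) := finiteDirectSums π.IsSaguaro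

/-- The category `𝒮^∞` of finite direct sums of saguaros of finite projective dimension. -/
def saguaroCatInf : ObjectProperty (ModuleCat.{x} Λ) :=
  finiteDirectSums fun M => π.IsSaguaro M ∧ HasFiniteProjectiveDimension M

end SplitPresentation

end

/-! A uniserial module with mast `p` and top element `t` has the basis `u t`, where `u` runs through
the right subpaths of `p`. Its structure constants in this basis form a point of `V_p`, and this
point determines the annihilator of `t`. The lengths of masts are bounded, so if the `V_p` are
finite, there are only finitely many pairs (annihilator of `t`, mast). If all graphs are edge paths,
the structure constants are zero and the same conclusion holds. Either hypothesis also makes masts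
unique. In the first case this is because two parallel arrows would give a `V_p` that is an affine
space of positive dimension over an infinite field.

In a saguaro the trunks embed, so the glued elements of two neighbouring trunks have equal
annihilators. Uniqueness of masts then forces both masts to continue the two subpaths in the same
way (`HasUniqueMasts.sameTail`). A gluing of neighbours is therefore recorded by one number, the
length of the common end. For arbitrary trunks `i`, `j` let `d i j` be the minimum of these numbers
between them. This is an ultrametric on a reversed scale on the set of trunks, which are coloured by
the finitely many pairs, and the saguaro can be rebuilt from these data (`IsSaguaroOn.exists_data`).

If there are too many trunks, the pigeonhole principle yields two disjoint balls with a
colour-preserving isometry between them, all cross values of `d` being the same number `g`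
(`exists_retraction_of_card_ball`). Let `r` fold one ball onto the other. The differences of the
generators `i` and `r i` generate a complement of the submodule generated by the fixed trunks
(`Glue.nonempty_equiv_prod`). This complement is again a saguaro, on trunks that have lost their
submodules of length `g + 1`. Both summands have fewer trunks, so induction leaves saguaros with
boundedly many trunks, which are given by finitely many data.

Finite projective dimension passes to direct summands, which settles the second category.
Approximations exist because the spaces of homomorphisms are finite-dimensional over `K`. -/

namespace QPath

variable {V : Type u} [Quiver.{v} V]

/-! ### Right subpaths as truncations, and common ends of paths -/

/-- Delete the last arrow of a path; trivial paths are left unchanged. -/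
def dropLast : QPath V → QPath V
  | ⟨a, _, Quiver.Path.nil⟩ => ⟨a, a, Quiver.Path.nil⟩
  | ⟨a, _, Quiver.Path.cons q _⟩ => ⟨a, _, q⟩

/-- Delete the last `n` arrows of a path. -/
def trunc (n : ℕ) (p : QPath V) : QPath V := dropLast^[n] p

theorem trunc_trunc (m n : ℕ) (p : QPath V) : trunc m (trunc n p) = trunc (m + n) p :=
  (Function.iterate_add_apply dropLast m n p).symm

theorem trunc_comp {a b : V} (y : Quiver.Path a b) :
    ∀ {c : V} (s : Quiver.Path b c), trunc s.length ⟨a, c, y.comp s⟩ = ⟨a, b, y⟩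
  | _, Quiver.Path.nil => rfl
  | _, Quiver.Path.cons s _ => trunc_comp y s

theorem exists_eq_comp_trunc {n : ℕ} {p : QPath V} (h : n ≤ p.length) :
    ∃ (a b c : V) (y : Quiver.Path a b) (s : Quiver.Path b c),
      p = ⟨a, c, y.comp s⟩ ∧ s.length = n ∧ trunc n p = ⟨a, b, y⟩ := by
  obtain ⟨a, c, p⟩ := p
  obtain ⟨b, y, s, rfl, hl⟩ := p.exists_eq_comp_of_le_length (n := p.length - n) (by omega)
  have hs : s.length = n := by
    have h' : n ≤ y.length + s.length := by simpa [length] using h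
    rw [Quiver.Path.length_comp] at hl
    omega
  refine ⟨a, b, c, y, s, rfl, hs, ?_⟩
  rw [← hs, trunc_comp]

theorem length_trunc {n : ℕ} {p : QPath V} (h : n ≤ p.length) :
    (trunc n p).length = p.length - n := by
  obtain ⟨a, b, c, y, s, rfl, rfl, ht⟩ := exists_eq_comp_trunc h
  rw [ht]
  simp [length]

theorem isRightSubpath_trunc {n : ℕ} {p : QPath V} (h : n ≤ p.length) :
    IsRightSubpath (trunc n p) p := by
  obtain ⟨a, b, c, y, s, rfl, rfl, ht⟩ := exists_eq_comp_trunc h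
  exact ⟨a, b, c, y, s, ht, rfl⟩

theorem IsRightSubpath.length_le {u p : QPath V} (h : IsRightSubpath u p) :
    u.length ≤ p.length := by
  obtain ⟨a, b, c, y, s, rfl, rfl⟩ := h
  simp [length]

theorem IsRightSubpath.eq_trunc {u p : QPath V} (h : IsRightSubpath u p) :
    u = trunc (p.length - u.length) p := by
  obtain ⟨a, b, c, y, s, rfl, rfl⟩ := h
  have : (⟨a, c, y.comp s⟩ : QPath V).length - (⟨a, b, y⟩ : QPath V).length = s.length := by
    simp [length]
  rw [this, trunc_comp]

theorem IsRightSubpath.eq_of_length_eq {u u' p : QPath V} (h : IsRightSubpath u p)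
    (h' : IsRightSubpath u' p) (hl : u.length = u'.length) : u = u' := by
  rw [h.eq_trunc, h'.eq_trunc, hl]

theorem isRightSubpath_refl (p : QPath V) : IsRightSubpath p p :=
  isRightSubpath_trunc (n := 0) (Nat.zero_le _)

theorem IsRightSubpath.of_cons {u p : QPath V} {d : V} {α : u.tgt ⟶ d}
    (h : IsRightSubpath (u.cons α) p) : IsRightSubpath u p := by
  obtain ⟨a, b, u⟩ := u
  obtain ⟨a', b', c, y, s, h1, rfl⟩ := h
  injection h1 with h1 h2 h3
  subst h1 h2
  obtain rfl := eq_of_heq h3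
  exact ⟨a, b, c, u, (Quiver.Hom.toPath α).comp s, rfl, by
    rw [← Quiver.Path.comp_assoc]; rfl⟩

theorem isRightSubpath_triv_src (p : QPath V) : IsRightSubpath (triv p.src) p :=
  ⟨p.src, p.src, p.tgt, Quiver.Path.nil, p.path, rfl, by simp⟩

@[simp]
theorem length_cons (u : QPath V) {d : V} (α : u.tgt ⟶ d) : (u.cons α).length = u.length + 1 :=
  rfl

@[simp]
theorem length_triv (a : V) : (triv a).length = 0 := rfl

/-- The last `n` arrows of the two paths exist and coincide. -/
def SameTail (n : ℕ) (p p' : QPath V) : Prop :=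
  ∃ (a a' b c : V) (y : Quiver.Path a b) (y' : Quiver.Path a' b) (s : Quiver.Path b c),
    s.length = n ∧ p = ⟨a, c, y.comp s⟩ ∧ p' = ⟨a', c, y'.comp s⟩

theorem SameTail.symm {n : ℕ} {p p' : QPath V} (h : SameTail n p p') : SameTail n p' p := by
  obtain ⟨a, a', b, c, y, y', s, hs, rfl, rfl⟩ := h
  exact ⟨a', a, b, c, y', y, s, hs, rfl, rfl⟩

theorem SameTail.le_length {n : ℕ} {p p' : QPath V} (h : SameTail n p p') : n ≤ p.length := by
  obtain ⟨a, a', b, c, y, y', s, rfl, rfl, rfl⟩ := h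
  simp [length]

theorem SameTail.mono {m n : ℕ} {p p' : QPath V} (h : SameTail n p p') (hmn : m ≤ n) :
    SameTail m p p' := by
  obtain ⟨a, a', b, c, y, y', s, rfl, rfl, rfl⟩ := h
  obtain ⟨d, s₁, s₂, rfl, hl⟩ := s.exists_eq_comp_of_le_length (n := s.length - m) (by omega)
  refine ⟨a, a', d, c, y.comp s₁, y'.comp s₁, s₂, ?_, ?_, ?_⟩
  · rw [Quiver.Path.length_comp] at hl hmn
    omega
  · rw [Quiver.Path.comp_assoc]
  · rw [Quiver.Path.comp_assoc]

theorem comp_right_unique {a c : V} : ∀ {b b' : V} (y : Quiver.Path a b) (s : Quiver.Path b c)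
    (y' : Quiver.Path a b') (s' : Quiver.Path b' c), y.comp s = y'.comp s' →
    s.length = s'.length → (⟨b, c, s⟩ : QPath V) = ⟨b', c, s'⟩ := by
  intro b b' y s y' s' h hl
  have hl' : y.length = y'.length := by
    have := congrArg Quiver.Path.length h
    simp only [Quiver.Path.length_comp] at this
    omega
  have := comp_left_unique y s y' s' h hl'
  injection this with h1 h2 h3
  subst h2
  rw [(Quiver.Path.comp_inj hl).1 h |>.2]

theorem SameTail.trans {n : ℕ} {p p' p'' : QPath V} (h : SameTail n p p')
    (h' : SameTail n p' p'') : SameTail n p p'' := by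
  obtain ⟨a, a', b, c, y, y', s, rfl, rfl, rfl⟩ := h
  obtain ⟨d, d', b', c', z, z', s', hs, h1, rfl⟩ := h'
  injection h1 with h1 h2 h3
  subst h1 h2
  have := comp_right_unique y' s z s' (eq_of_heq h3) hs.symm
  injection this with h4 h5 h6
  subst h4
  obtain rfl := eq_of_heq h6
  exact ⟨a, d', b, c, y, z', s, rfl, rfl, rfl⟩

theorem SameTail.refl {n : ℕ} {p : QPath V} (h : n ≤ p.length) : SameTail n p p := by
  obtain ⟨a, b, c, y, s, rfl, rfl, -⟩ := exists_eq_comp_trunc h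
  exact ⟨a, a, b, c, y, y, s, rfl, rfl, rfl⟩

theorem SameTail.trunc {m n : ℕ} {p p' : QPath V} (h : SameTail (m + n) p p') :
    SameTail m (trunc n p) (trunc n p') := by
  obtain ⟨a, a', b, c, y, y', s, hs, rfl, rfl⟩ := h
  obtain ⟨d, s₁, s₂, rfl, hl⟩ := s.exists_eq_comp_of_le_length (n := m) (by omega)
  have hn : s₂.length = n := by
    rw [Quiver.Path.length_comp] at hs
    omega
  subst hn
  refine ⟨a, a', b, d, y, y', s₁, hl, ?_, ?_⟩
  · rw [← Quiver.Path.comp_assoc, trunc_comp]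
  · rw [← Quiver.Path.comp_assoc, trunc_comp]

theorem finite_length_eq [Finite V] [∀ a b : V, Finite (a ⟶ b)] (n : ℕ) :
    {p : QPath V | p.length = n}.Finite := by
  induction n with
  | zero =>
    refine (Set.finite_range (triv : V → QPath V)).subset ?_
    rintro ⟨a, b, p⟩ hp
    cases p with
    | nil => exact ⟨a, rfl⟩
    | cons p e => simp [length] at hp
  | succ n ih =>
    have := ih.to_subtype
    refine (Set.finite_range (fun z : (Σ u : {p : QPath V | p.length = n}, Σ d : V, u.1.tgt ⟶ d) =>
      z.1.1.cons z.2.2)).subset ?_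
    rintro ⟨a, b, p⟩ hp
    cases p with
    | nil => simp [length] at hp
    | cons p e => exact ⟨⟨⟨⟨a, _, p⟩, by simpa [length] using hp⟩, _, e⟩, rfl⟩

theorem finite_length_lt [Finite V] [∀ a b : V, Finite (a ⟶ b)] (n : ℕ) :
    {p : QPath V | p.length < n}.Finite := by
  have : {p : QPath V | p.length < n} = ⋃ m ∈ Set.Iio n, {p : QPath V | p.length = m} := by
    ext p; simp
  rw [this]
  exact (Set.finite_Iio n).biUnion fun m _ => finite_length_eq m

end QPath

/-! ### Residue classes of paths and powers of the arrow ideal -/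

namespace SplitPresentation

variable {K : Type w} [Field K] {V : Type u} [Quiver.{v} V] [Fintype V] {Λ : Type x} [Ring Λ]
  [Algebra K Λ] (π : SplitPresentation K V Λ)

theorem path_mul_path {a b c : V} (y : Quiver.Path b c) (x : Quiver.Path a b) :
    π.path ⟨b, c, y⟩ * π.path ⟨a, b, x⟩ = π.path ⟨a, c, x.comp y⟩ := by
  rw [path, path, ← map_mul, PathAlgebra.ofPath_mul_ofPath, PathAlgebra.mulPath_of_eq, path]

theorem path_mul_path_of_ne {p q : QPath V} (h : q.tgt ≠ p.src) : π.path p * π.path q = 0 := by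
  rw [path, path, ← map_mul, PathAlgebra.ofPath_mul_ofPath, PathAlgebra.mulPath_of_ne h, map_zero]

theorem path_mul_path_cases (p q : QPath V) :
    π.path p * π.path q = 0 ∨ ∃ r : QPath V, r.length = p.length + q.length ∧ r.src = q.src ∧
      r.tgt = p.tgt ∧ π.path p * π.path q = π.path r := by
  by_cases h : q.tgt = p.src
  · obtain ⟨a, b, q⟩ := q
    obtain ⟨b', c, p⟩ := p
    obtain rfl : b = b' := h
    exact Or.inr ⟨⟨a, c, q.comp p⟩, by simp [QPath.length, add_comm], rfl, rfl,
      π.path_mul_path p q⟩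
  · exact Or.inl (π.path_mul_path_of_ne h)

theorem path_cons (u : QPath V) {d : V} (α : u.tgt ⟶ d) :
    π.path (u.cons α) = π.path ⟨u.tgt, d, Quiver.Hom.toPath α⟩ * π.path u := by
  obtain ⟨a, b, u⟩ := u
  rw [path_mul_path]
  rfl

theorem triv_mul_path (p : QPath V) : π.path (QPath.triv p.tgt) * π.path p = π.path p :=
  π.path_mul_path Quiver.Path.nil p.path

theorem path_mul_triv (p : QPath V) : π.path p * π.path (QPath.triv p.src) = π.path p := by
  obtain ⟨a, b, p⟩ := p
  have := π.path_mul_path p (Quiver.Path.nil : Quiver.Path a a)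
  rwa [Quiver.Path.nil_comp] at this

theorem triv_mul_path_of_ne {a : V} {p : QPath V} (h : p.tgt ≠ a) :
    π.path (QPath.triv a) * π.path p = 0 := π.path_mul_path_of_ne h

theorem toAlgHom_eq_sum (z : PathAlgebra K V) :
    π.toAlgHom z = Finsupp.sum (z : QPath V →₀ K) fun p c => c • π.path p := by
  induction z using PathAlgebra.induction_ofPath with
  | h0 => rw [map_zero]; exact Finsupp.sum_zero_index.symm
  | hadd x y hx hy =>
    rw [map_add, hx, hy]
    exact (Finsupp.sum_add_index' (by simp) (by simp [add_smul])).symm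
  | hpath c p =>
    have e : (c • PathAlgebra.ofPath p : PathAlgebra K V) =
        (Finsupp.single p c : QPath V →₀ K) := by
      simp only [PathAlgebra.ofPath]
      erw [Finsupp.smul_single, smul_eq_mul, mul_one]
    rw [map_smul, e, Finsupp.sum_single_index (by simp)]
    rfl

/-- The span of the residue classes of the paths of length at least `n`. -/
def pathFiltration (n : ℕ) : Submodule K Λ :=
  Submodule.span K {y | ∃ p : QPath V, n ≤ p.length ∧ π.path p = y}

theorem path_mem_pathFiltration {n : ℕ} {p : QPath V} (h : n ≤ p.length) :
    π.path p ∈ π.pathFiltration n := Submodule.subset_span ⟨p, h, rfl⟩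

theorem mem_pathFiltration_zero (y : Λ) : y ∈ π.pathFiltration 0 := by
  obtain ⟨z, rfl⟩ := π.surjective y
  rw [toAlgHom_eq_sum]
  exact Submodule.sum_mem _ fun p _ =>
    Submodule.smul_mem _ _ (π.path_mem_pathFiltration (Nat.zero_le _))

theorem mul_mem_pathFiltration {m n : ℕ} {y z : Λ} (hy : y ∈ π.pathFiltration m)
    (hz : z ∈ π.pathFiltration n) : y * z ∈ π.pathFiltration (m + n) := by
  induction hy using Submodule.span_induction with
  | zero => simp
  | add y y' _ _ h h' => rw [add_mul]; exact add_mem h h'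
  | smul c y _ h => rw [smul_mul_assoc]; exact Submodule.smul_mem _ _ h
  | mem y hy =>
    obtain ⟨p, hp, rfl⟩ := hy
    induction hz using Submodule.span_induction with
    | zero => simp
    | add y y' _ _ h h' => rw [mul_add]; exact add_mem h h'
    | smul c y _ h => rw [mul_smul_comm]; exact Submodule.smul_mem _ _ h
    | mem z hz =>
      obtain ⟨q, hq, rfl⟩ := hz
      obtain h | ⟨r, hr, -, -, h⟩ := π.path_mul_path_cases p q
      · rw [h]; exact zero_mem _
      · rw [h]; exact π.path_mem_pathFiltration (by omega)

theorem exists_pathFiltration_eq_bot : ∃ N : ℕ, π.pathFiltration N = ⊥ := by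
  obtain ⟨N, hN⟩ := π.exists_pow_le
  refine ⟨N, ?_⟩
  rw [pathFiltration, Submodule.span_eq_bot]
  rintro _ ⟨p, hp, rfl⟩
  exact hN p hp

theorem pow_mem_pathFiltration {y : Λ} (hy : y ∈ π.pathFiltration 1) (n : ℕ) :
    y ^ n ∈ π.pathFiltration n := by
  induction n with
  | zero => exact π.mem_pathFiltration_zero _
  | succ n ih => rw [pow_succ]; exact π.mul_mem_pathFiltration ih hy

theorem isNilpotent_of_mem {y : Λ} (hy : y ∈ π.pathFiltration 1) : IsNilpotent y := by
  obtain ⟨N, hN⟩ := π.exists_pathFiltration_eq_bot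
  refine ⟨N, ?_⟩
  have := π.pow_mem_pathFiltration hy N
  rwa [hN, Submodule.mem_bot] at this

theorem mul_mem_pathFiltration_one (y : Λ) {z : Λ} (hz : z ∈ π.pathFiltration 1) :
    y * z ∈ π.pathFiltration 1 := by
  simpa using π.mul_mem_pathFiltration (π.mem_pathFiltration_zero y) hz

/-- Each left multiple `z * y` is nilpotent, so `1 - z * y` is a unit and lies in no maximal left
ideal. Only this inclusion between the arrow ideal and the radical is needed. -/
theorem mem_jacobson_of_mem {y : Λ} (hy : y ∈ π.pathFiltration 1) : y ∈ Ring.jacobson Λ := by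
  rw [Ring.jacobson_eq_sInf_isMaximal, Submodule.mem_sInf]
  intro m hm
  by_contra hym
  obtain ⟨z, hz⟩ := (Ideal.IsMaximal.exists_inv hm hym)
  obtain ⟨i, hi, e⟩ := hz
  have hu : IsUnit (1 - z * y) :=
    (π.isNilpotent_of_mem (π.mul_mem_pathFiltration_one z hy)).isUnit_one_sub
  refine hm.ne_top (Ideal.eq_top_of_isUnit_mem m ?_ hu)
  rw [← e]
  simpa using hi

/-- An element that is a multiple of itself by something in the arrow ideal vanishes. -/
theorem eq_zero_of_eq_smul {M : Type*} [AddCommGroup M] [Module Λ M] {r : Λ}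
    (hr : r ∈ π.pathFiltration 1) {y : M} (h : y = r • y) : y = 0 := by
  have key : ∀ n : ℕ, y = r ^ n • y := by
    intro n
    induction n with
    | zero => simp
    | succ n ih => rw [pow_succ, mul_smul, ← h]; exact ih
  obtain ⟨n, hn⟩ := π.isNilpotent_of_mem hr
  rw [key n, hn, zero_smul]

theorem smul_mem_radicalSubmodule {M : Type x} [AddCommGroup M] [Module Λ M] {r : Λ}
    (hr : r ∈ π.pathFiltration 1) (y : M) : r • y ∈ radicalSubmodule Λ M :=
  Submodule.smul_mem_smul (π.mem_jacobson_of_mem hr) Submodule.mem_top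

/-- The multiplier is the stretch of the common end between the depths `n` and `m`. One element
serves both paths, so a gluing at depth `n` implies the gluings at all smaller depths. -/
theorem exists_mul_of_sameTail {n m : ℕ} {p p' : QPath V} (h : QPath.SameTail n p p')
    (hm : m ≤ n) : ∃ r : Λ, π.path (p.trunc m) = r * π.path (p.trunc n) ∧
      π.path (p'.trunc m) = r * π.path (p'.trunc n) := by
  obtain ⟨a, a', b, c, y, y', s, rfl, rfl, rfl⟩ := h
  obtain ⟨d, s₁, s₂, rfl, hl⟩ := s.exists_eq_comp_of_le_length (n := s.length - m) (by omega)
  have hm' : s₂.length = m := by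
    rw [Quiver.Path.length_comp] at hl hm
    omega
  subst hm'
  refine ⟨π.path ⟨b, d, s₁⟩, ?_, ?_⟩ <;>
  rw [QPath.trunc_comp, path_mul_path, ← Quiver.Path.comp_assoc, QPath.trunc_comp]

theorem exists_path_eq_mul_trunc {n : ℕ} {p : QPath V} (h : n ≤ p.length) :
    ∃ s : QPath V, s.length = n ∧ π.path p = π.path s * π.path (p.trunc n) := by
  obtain ⟨a, b, c, y, s, rfl, rfl, ht⟩ := QPath.exists_eq_comp_trunc h
  exact ⟨⟨b, c, s⟩, rfl, by rw [ht, path_mul_path]⟩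

theorem path_trunc_mem_span {n m : ℕ} {p : QPath V} (h : n ≤ p.length) (hm : m ≤ n) :
    π.path (p.trunc m) ∈ Submodule.span Λ {π.path (p.trunc n)} := by
  obtain ⟨r, hr, -⟩ := π.exists_mul_of_sameTail (QPath.SameTail.refl h) hm
  rw [hr]
  exact Submodule.smul_mem _ r (Submodule.mem_span_singleton_self _)

end SplitPresentation

theorem length_eq_length_add_length_quotient {R M : Type*} [Ring R] [AddCommGroup M] [Module R M]
    (A : Submodule R M) :
    Module.length R M = Module.length R A + Module.length R (M ⧸ A) :=
  Module.length_eq_add_of_exact A.subtype A.mkQ A.injective_subtype A.mkQ_surjective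
    (LinearMap.exact_subtype_mkQ A)

/-! ### Lengths, masts and top elements of uniserial modules -/

namespace SplitPresentation

variable {K : Type w} [Field K] {V : Type u} [Quiver.{v} V] [Fintype V] {Λ : Type x} [Ring Λ]
  [Algebra K Λ] (π : SplitPresentation K V Λ)

theorem eq_zero_of_smul_eq_zero {T : Type*} [AddCommGroup T] [Module Λ T] {c : K} {r : Λ} {y : T}
    (h : (c • r) • y = 0) (hy : r • y ≠ 0) : c = 0 := by
  by_contra hc
  apply hy
  rw [← inv_smul_smul₀ hc r, Algebra.smul_def, mul_smul, h, smul_zero]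

/-- Otherwise a nilpotent element `s * r` would fix `y`. This strictness is what produces a
composition factor for each arrow of a path. -/
theorem notMem_span_smul {M : Type x} [AddCommGroup M] [Module Λ M] {r : Λ}
    (hr : r ∈ π.pathFiltration 1) {y : M} (hy : y ≠ 0) : y ∉ Submodule.span Λ {r • y} := by
  intro h
  obtain ⟨s, hs⟩ := Submodule.mem_span_singleton.1 h
  rw [smul_smul] at hs
  exact hy (π.eq_zero_of_eq_smul (π.mul_mem_pathFiltration_one s hr) hs.symm)

/-- A module on which a path acts nontrivially is longer than the path. -/
theorem length_add_one_le_of_smul_ne_zero {M : Type x} [AddCommGroup M] [Module Λ M] (p : QPath V)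
    (y : M) (h : π.path p • y ≠ 0) : (p.length : ℕ∞) + 1 ≤ Module.length Λ M := by
  obtain ⟨a, b, p⟩ := p
  induction p generalizing M with
  | nil =>
    have : Nontrivial M := ⟨_, _, h⟩
    simpa [QPath.length, Order.one_le_iff_pos] using Module.length_pos (R := Λ) (M := M)
  | @cons b c p α ih =>
    have e : π.path ⟨a, c, p.cons α⟩ = π.path ⟨b, c, Quiver.Hom.toPath α⟩ * π.path ⟨a, b, p⟩ :=
      π.path_cons ⟨a, b, p⟩ α
    rw [e, mul_smul] at h
    set r := π.path ⟨b, c, Quiver.Hom.toPath α⟩ with hr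
    have hr1 : r ∈ π.pathFiltration 1 := π.path_mem_pathFiltration (by simp [QPath.length])
    -- Dividing by `A` loses at least one composition factor, while the shorter path still acts
    -- nontrivially on the quotient.
    set A : Submodule Λ M := Submodule.span Λ {r • π.path ⟨a, b, p⟩ • y}
    have hz : π.path ⟨a, b, p⟩ • y ≠ 0 := fun h0 => h (by rw [h0, smul_zero])
    have h1 := ih (M := M ⧸ A) (A.mkQ y) (by
      rw [← map_smul, Submodule.mkQ_apply, Ne, Submodule.Quotient.mk_eq_zero]
      exact π.notMem_span_smul hr1 hz)
    have : Nontrivial A := ⟨⟨_, Submodule.mem_span_singleton_self _⟩, 0, fun h0 =>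
      h (congrArg Subtype.val h0)⟩
    have h2 : 1 ≤ Module.length Λ A := Order.one_le_iff_pos.2 Module.length_pos
    rw [length_eq_length_add_length_quotient A, add_comm (Module.length Λ A)]
    have h3 : ((⟨a, c, p.cons α⟩ : QPath V).length : ℕ∞) = (⟨a, b, p⟩ : QPath V).length + 1 := by
      simp [QPath.length]
    rw [h3]
    exact add_le_add h1 h2

/-- `t` is a top element of the uniserial module `T` with mast `p`. -/
structure IsTrunk (p : QPath V) {T : Type x} [AddCommGroup T] [Module Λ T] (t : T) : Prop where
  uniserial : IsUniserial Λ T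
  mast : π.IsMast p T
  top : π.IsTopElement t

namespace IsTrunk

variable {π} {p : QPath V} {T : Type x} [AddCommGroup T] [Module Λ T] {t : T}

theorem smul_eq_zero_of_length_lt (h : π.IsTrunk p t) {q : QPath V} (hq : p.length < q.length)
    (y : T) : π.path q • y = 0 := by
  by_contra h0
  have h1 := π.length_add_one_le_of_smul_ne_zero q y h0
  rw [h.mast.1] at h1
  have : q.length + 1 ≤ p.length + 1 := by exact_mod_cast h1
  omega

theorem length_ne_top (h : π.IsTrunk p t) : Module.length Λ T ≠ ⊤ := by
  rw [h.mast.1]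
  exact ENat.natCast_ne_top (p.length + 1)

/-- The path `p` acts nontrivially on the submodule generated by `y`, which is therefore as long as
`T`. -/
theorem span_eq_top_of_smul_ne_zero (h : π.IsTrunk p t) {y : T} (hy : π.path p • y ≠ 0) :
    Submodule.span Λ {y} = ⊤ := by
  have h1 := π.length_add_one_le_of_smul_ne_zero (M := Submodule.span Λ {y}) p
    ⟨y, Submodule.mem_span_singleton_self y⟩ (fun h0 => hy (congrArg Subtype.val h0))
  obtain ⟨_, _⟩ := isFiniteLength_iff_isNoetherian_isArtinian.1 h.uniserial.1
  by_contra hne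
  have h2 := Submodule.length_lt hne
  rw [h.mast.1] at h2
  exact absurd h2 (not_lt.2 h1)

theorem smul_eq_zero_of_mem_pathFiltration (h : π.IsTrunk p t) {r : Λ}
    (hr : r ∈ π.pathFiltration (p.length + 1)) (y : T) : r • y = 0 := by
  induction hr using Submodule.span_induction with
  | zero => simp
  | add r r' _ _ h h' => rw [add_smul, h, h', add_zero]
  | smul c r _ h => rw [Algebra.smul_def, mul_smul, h, smul_zero]
  | mem r hr =>
    obtain ⟨q, hq, rfl⟩ := hr
    exact h.smul_eq_zero_of_length_lt hq y

end IsTrunk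

/-- This is where splitness enters: modulo the arrow ideal, a multiple of a trivial path is a scalar
multiple. -/
theorem exists_mul_triv_eq (z : Λ) (a : V) : ∃ (c : K) (r : Λ), r ∈ π.pathFiltration 1 ∧
    z * π.path (QPath.triv a) = c • π.path (QPath.triv a) + r := by
  have hz := π.mem_pathFiltration_zero z
  induction hz using Submodule.span_induction with
  | zero => exact ⟨0, 0, zero_mem _, by simp⟩
  | add z z' _ _ h h' =>
    obtain ⟨c, r, hr, e⟩ := h
    obtain ⟨c', r', hr', e'⟩ := h'
    exact ⟨c + c', r + r', add_mem hr hr', by rw [add_mul, e, e', add_smul]; abel⟩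
  | smul d z _ h =>
    obtain ⟨c, r, hr, e⟩ := h
    exact ⟨d * c, d • r, Submodule.smul_mem _ _ hr, by
      rw [smul_mul_assoc, e, smul_add, smul_smul]⟩
  | mem z hz =>
    obtain ⟨⟨b, c, q⟩, -, rfl⟩ := hz
    cases q with
    | nil =>
      by_cases hb : a = b
      · subst hb
        exact ⟨1, 0, zero_mem _, by rw [one_smul, add_zero]; exact π.triv_mul_path (QPath.triv a)⟩
      · exact ⟨0, 0, zero_mem _, by rw [π.path_mul_path_of_ne hb]; simp⟩
    | cons q α =>
      refine ⟨0, _, ?_, by rw [zero_smul, zero_add]⟩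
      have := π.mul_mem_pathFiltration
        (π.path_mem_pathFiltration (p := ⟨b, c, q.cons α⟩) (n := 1) (by simp [QPath.length]))
        (π.mem_pathFiltration_zero (π.path (QPath.triv a)))
      simpa using this

namespace IsTrunk

variable {π} {p : QPath V} {T : Type x} [AddCommGroup T] [Module Λ T] {t : T}

/-- The definition of a mast supplies some generator `y` with `p y ≠ 0`, of the type of the start of
`p`. Write `t = c y + r y` with `r` in the arrow ideal. Then `c ≠ 0` because `t` lies outside the
radical. Hence `t` has the type of `y`, and `p t = c p y` because `p r` is too long to act. -/
theorem triv_smul_and_smul_ne_zero (h : π.IsTrunk p t) :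
    π.path (QPath.triv p.src) • t = t ∧ π.path p • t ≠ 0 := by
  obtain ⟨y₀, hy₀⟩ := h.mast.2
  obtain ⟨a, hat, ha⟩ := h.top
  set y := π.path (QPath.triv p.src) • y₀ with hy
  have hpy : π.path p • y ≠ 0 := by rwa [hy, smul_smul, path_mul_triv]
  have htop := h.span_eq_top_of_smul_ne_zero hpy
  have hey : π.path (QPath.triv p.src) • y = y := by
    rw [hy, smul_smul]; congr 1; exact π.triv_mul_path (QPath.triv p.src)
  clear_value y
  obtain ⟨z, hz⟩ := Submodule.mem_span_singleton.1 (htop ▸ Submodule.mem_top : t ∈ _)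
  obtain ⟨c, r, hr, e⟩ := π.exists_mul_triv_eq z p.src
  have ht : t = algebraMap K Λ c • y + r • y := by
    rw [← hz]
    nth_rw 1 [← hey]
    rw [smul_smul, e, add_smul, Algebra.smul_def, mul_smul, hey]
  have hc : c ≠ 0 := by
    rintro rfl
    rw [map_zero, zero_smul, zero_add] at ht
    exact hat (ht ▸ π.smul_mem_radicalSubmodule hr y)
  have hsrc : a = p.src := by
    by_contra hne
    have h0 : π.path (QPath.triv a) • y = 0 := by
      rw [← hey, smul_smul, π.triv_mul_path_of_ne (p := QPath.triv p.src) (Ne.symm hne), zero_smul]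
    apply hat
    rw [← ha, ht, smul_add, smul_smul, ← Algebra.commutes, mul_smul, h0, smul_zero, zero_add,
      smul_smul]
    exact π.smul_mem_radicalSubmodule (π.mul_mem_pathFiltration_one _ hr) y
  subst hsrc
  refine ⟨ha, ?_⟩
  have h1 : (π.path p * r) • y = 0 := h.smul_eq_zero_of_mem_pathFiltration
    (π.mul_mem_pathFiltration (π.path_mem_pathFiltration le_rfl) hr) y
  rw [ht, smul_add, smul_smul, smul_smul, h1, add_zero, ← Algebra.commutes, mul_smul]
  exact fun h0 => hc (eq_zero_of_smul_eq_zero (r := π.path p)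
    (by rwa [Algebra.smul_def, mul_smul]) hpy)

theorem triv_smul (h : π.IsTrunk p t) : π.path (QPath.triv p.src) • t = t :=
  h.triv_smul_and_smul_ne_zero.1

theorem smul_ne_zero (h : π.IsTrunk p t) : π.path p • t ≠ 0 := h.triv_smul_and_smul_ne_zero.2

theorem span_eq_top (h : π.IsTrunk p t) : Submodule.span Λ {t} = ⊤ :=
  h.span_eq_top_of_smul_ne_zero h.smul_ne_zero

theorem smul_surjective (h : π.IsTrunk p t) (y : T) : ∃ r : Λ, r • t = y :=
  Submodule.mem_span_singleton.1 (h.span_eq_top ▸ Submodule.mem_top)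

theorem trunc_smul_ne_zero (h : π.IsTrunk p t) {n : ℕ} (hn : n ≤ p.length) :
    π.path (p.trunc n) • t ≠ 0 := by
  obtain ⟨s, -, hs⟩ := π.exists_path_eq_mul_trunc hn
  intro h0
  apply h.smul_ne_zero
  rw [hs, mul_smul, h0, smul_zero]

theorem isTopElementOfType (h : π.IsTrunk p t) : π.IsTopElementOfType p.src t :=
  ⟨h.top.choose_spec.1, h.triv_smul⟩

theorem path_smul_of_src_ne (h : π.IsTrunk p t) {q : QPath V} (hq : p.src ≠ q.src) :
    π.path q • t = 0 := by
  rw [← h.triv_smul, smul_smul, π.path_mul_path_of_ne (q := QPath.triv p.src) hq, zero_smul]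

/-- The quotient of a trunk by the submodule of length `n + 1`. -/
theorem quotient (h : π.IsTrunk p t) {n : ℕ} (hn : n < p.length) :
    π.IsTrunk (p.trunc (n + 1))
      ((Submodule.span Λ {π.path (p.trunc n) • t}).mkQ t) := by
  set X := Submodule.span Λ {π.path (p.trunc n) • t} with hX
  have hlen : (p.trunc n).length = p.length - n := QPath.length_trunc hn.le
  have hJ : X ≤ radicalSubmodule Λ T := by
    rw [hX, Submodule.span_singleton_le_iff_mem]
    exact π.smul_mem_radicalSubmodule (π.path_mem_pathFiltration (by omega)) t
  have htX : t ∉ X := fun hm => h.isTopElementOfType.1 (hJ hm)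
  obtain ⟨s, hs, e⟩ := π.exists_path_eq_mul_trunc (p := p.trunc n) (n := 1) (by omega)
  rw [QPath.trunc_trunc, add_comm 1 n] at e
  have hp' : π.path (p.trunc (n + 1)) • X.mkQ t ≠ 0 := by
    rw [← map_smul, Submodule.mkQ_apply, Ne, Submodule.Quotient.mk_eq_zero, hX, e, mul_smul]
    exact π.notMem_span_smul (π.path_mem_pathFiltration hs.ge) (h.trunc_smul_ne_zero hn)
  have hlen' : (p.trunc (n + 1)).length = p.length - (n + 1) := QPath.length_trunc hn
  -- With `l` the length of `p`, the lower bounds `l - n` for the quotient and `n + 1` for `X` add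
  -- up to the length `l + 1` of `T`, so they are attained.
  have h1 := π.length_add_one_le_of_smul_ne_zero _ _ hp'
  obtain ⟨s', hs', e'⟩ := π.exists_path_eq_mul_trunc hn.le
  have h2 := π.length_add_one_le_of_smul_ne_zero (M := X) s'
    ⟨_, Submodule.mem_span_singleton_self _⟩ (by
      intro h0
      apply h.smul_ne_zero
      rw [e', mul_smul]
      exact congrArg Subtype.val h0)
  have h3 := length_eq_length_add_length_quotient X
  refine ⟨⟨IsFiniteLength.of_surjective h.uniserial.1 X.mkQ_surjective, ⟨X.mkQ t, 0, ?_⟩, ?_⟩,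
    ⟨?_, _, hp'⟩, p.src, ?_, ?_⟩
  · rwa [Submodule.mkQ_apply, Ne, Submodule.Quotient.mk_eq_zero]
  · intro A B
    refine (h.uniserial.2.2 (A.comap X.mkQ) (B.comap X.mkQ)).imp ?_ ?_ <;>
    exact fun hle => (Submodule.comap_le_comap_iff_of_surjective X.mkQ_surjective).1 hle
  · rw [h.mast.1] at h3
    have hne := h.length_ne_top
    rw [h.mast.1, h3] at hne
    obtain ⟨a, ha⟩ := ENat.ne_top_iff_exists.1 fun ht : Module.length Λ X = ⊤ => hne (by simp [ht])
    obtain ⟨b, hb⟩ := ENat.ne_top_iff_exists.1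
      fun ht : Module.length Λ (T ⧸ X) = ⊤ => hne (by simp [ht])
    rw [← ha, ← hb] at h3
    rw [← hb] at h1 ⊢
    rw [← ha] at h2
    norm_cast at *
    omega
  · intro hm
    apply h.isTopElementOfType.1
    have hmap : radicalSubmodule Λ (T ⧸ X) = (radicalSubmodule Λ T).map X.mkQ := by
      rw [radicalSubmodule, radicalSubmodule, Submodule.map_smul'', Submodule.map_top,
        Submodule.range_mkQ]
    rw [hmap] at hm
    obtain ⟨y, hy, hyt⟩ := hm
    have := (Submodule.Quotient.eq X).1 hyt
    have h4 := sub_mem hy (hJ this)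
    simpa using h4
  · rw [← map_smul, h.triv_smul]

end IsTrunk

end SplitPresentation

/-! ### Coordinates of uniserial modules -/

namespace SplitPresentation

variable {K : Type w} [Field K] {V : Type u} [Quiver.{v} V] [Fintype V] {Λ : Type x} [Ring Λ]
  [Algebra K Λ] (π : SplitPresentation K V Λ)

/-- The linear combination of the right subpaths of `p` with the given coefficients. -/
noncomputable def subpathSum (p : QPath V) : (QPath.RightSubpath p → K) →ₗ[K] Λ :=
  Fintype.linearCombination K fun u : QPath.RightSubpath p => π.path u.1

theorem subpathSum_apply (p : QPath V) (c : QPath.RightSubpath p → K) :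
    π.subpathSum p c = ∑ u, c u • π.path u.1 := rfl

theorem subpathSum_single [DecidableEq (QPath V)] {p : QPath V} (u : QPath.RightSubpath p) (a : K) :
    π.subpathSum p (Pi.single u a) = a • π.path u.1 := by
  rw [subpathSum, Fintype.linearCombination_apply_single]

theorem smul_smul_eq_algebraMap_smul {T : Type*} [AddCommGroup T] [Module Λ T] (c : K) (r : Λ)
    (y : T) : (c • r) • y = algebraMap K Λ c • r • y := by
  rw [Algebra.smul_def, mul_smul]

namespace IsTrunk

variable {π} {p : QPath V} {T : Type x} [AddCommGroup T] [Module Λ T] {t : T}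

/-- Multiply a vanishing combination by the path that continues `u` to `p`. The terms of shorter
subpaths are gone by induction, those of longer ones become too long to act, and what is left is `c
u • p t`. -/
theorem subpathSum_smul_eq_zero_iff (h : π.IsTrunk p t) (c : QPath.RightSubpath p → K) :
    π.subpathSum p c • t = 0 ↔ c = 0 := by
  refine ⟨fun h0 => ?_, by rintro rfl; simp⟩
  have key : ∀ (n : ℕ) (u : QPath.RightSubpath p), u.1.length = n → c u = 0 := by
    intro n
    induction n using Nat.strong_induction_on with
    | _ n ih =>
      intro u hu
      have hul := u.2.length_le
      obtain ⟨s, hs, e⟩ := π.exists_path_eq_mul_trunc (p := p) (n := p.length - u.1.length)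
        (Nat.sub_le _ _)
      rw [← u.2.eq_trunc] at e
      have h1 : (c u • π.path p) • t = 0 := by
        have h2 := congrArg (fun m => π.path s • m) h0
        simp only [smul_zero] at h2
        rw [smul_smul, subpathSum_apply, Finset.mul_sum, Finset.sum_smul,
          Finset.sum_eq_single u] at h2
        · rwa [mul_smul_comm, ← e] at h2
        · intro v _ hvu
          rw [mul_smul_comm]
          rcases lt_trichotomy v.1.length u.1.length with hlt | heq | hgt
          · rw [ih _ (hu ▸ hlt) v rfl, zero_smul, zero_smul]
          · exact absurd (Subtype.ext (v.2.eq_of_length_eq u.2 heq)) hvu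
          · obtain h3 | ⟨r, hr, -, -, h3⟩ := π.path_mul_path_cases s v.1
            · rw [h3, smul_zero, zero_smul]
            · rw [h3, Algebra.smul_def, mul_smul, h.smul_eq_zero_of_length_lt (by omega),
                smul_zero]
        · simp
      exact eq_zero_of_smul_eq_zero h1 h.smul_ne_zero
  funext u
  exact key _ u rfl

/-- Submodules form a chain, so otherwise the submodule `A` generated by the left side properly
contains `X` and has length at least `n + 2`. But `T ⧸ A` has length at least `p.length - n`, since
`p.trunc (n + 1)` still acts nontrivially on it, and the sum exceeds the length of `T`. -/
theorem smul_trunc_succ_mem (h : π.IsTrunk p t) {n : ℕ} (hn : n < p.length) {r : Λ}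
    (hr : r ∈ π.pathFiltration 1) :
    r • π.path (p.trunc (n + 1)) • t ∈ Submodule.span Λ {π.path (p.trunc n) • t} := by
  set y := r • π.path (p.trunc (n + 1)) • t with hy
  set X := Submodule.span Λ {π.path (p.trunc n) • t}
  set A := Submodule.span Λ {y}
  suffices A ≤ X from this (Submodule.mem_span_singleton_self y)
  obtain hle | hle := h.uniserial.2.2 A X
  · exact hle
  obtain ⟨_, _⟩ := isFiniteLength_iff_isNoetherian_isArtinian.1 h.uniserial.1
  have h1 := π.length_add_one_le_of_smul_ne_zero (M := T ⧸ A) (p.trunc (n + 1)) (A.mkQ t) (by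
    rw [← map_smul, Submodule.mkQ_apply, Ne, Submodule.Quotient.mk_eq_zero]
    exact π.notMem_span_smul hr (h.trunc_smul_ne_zero hn))
  rw [QPath.length_trunc hn] at h1
  obtain ⟨s, hs, e⟩ := π.exists_path_eq_mul_trunc hn.le
  have h2 := π.length_add_one_le_of_smul_ne_zero (M := X) s
    ⟨_, Submodule.mem_span_singleton_self _⟩ (by
      intro h0
      apply h.smul_ne_zero
      rw [e, mul_smul]
      exact congrArg Subtype.val h0)
  have h3 := length_eq_length_add_length_quotient A
  by_contra hnot
  have h4 : Module.length Λ X < Module.length Λ A := by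
    rw [Module.length_submodule, Module.length_submodule]
    exact Submodule.height_strictMono (lt_of_le_not_ge hle hnot)
  rw [h.mast.1] at h3
  have hne := h.length_ne_top
  rw [h.mast.1, h3] at hne
  obtain ⟨a, ha⟩ := ENat.ne_top_iff_exists.1 fun ht : Module.length Λ A = ⊤ => hne (by simp [ht])
  obtain ⟨b, hb⟩ := ENat.ne_top_iff_exists.1
    fun ht : Module.length Λ (T ⧸ A) = ⊤ => hne (by simp [ht])
  obtain ⟨c, hc⟩ := ENat.ne_top_iff_exists.1 h4.ne_top
  rw [← ha, ← hb] at h3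
  rw [← hb] at h1
  rw [← hc] at h2
  rw [← ha, ← hc] at h4
  norm_cast at *
  omega

/-- One layer at a time: a multiple of `p.trunc n • t` is a scalar multiple plus an arrow ideal
multiple, and the latter falls into the next layer. -/
theorem exists_subpathSum_of_mem (h : π.IsTrunk p t) {n : ℕ} (hn : n ≤ p.length) :
    ∀ y ∈ Submodule.span Λ {π.path (p.trunc n) • t}, ∃ c : QPath.RightSubpath p → K,
      (∀ s, c s ≠ 0 → p.length - n ≤ s.1.length) ∧ π.subpathSum p c • t = y := by
  classical
  induction n with
  | zero =>
    intro y hy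
    obtain ⟨z, rfl⟩ := Submodule.mem_span_singleton.1 hy
    obtain ⟨c, r, hr, e⟩ := π.exists_mul_triv_eq z p.tgt
    refine ⟨Pi.single ⟨p, p.isRightSubpath_refl⟩ c, ?_, ?_⟩
    · intro s hs
      rw [Pi.single_apply] at hs
      obtain rfl : s = _ := by
        by_contra hne
        exact hs (if_neg hne)
      simp
    · rw [subpathSum_single]
      change _ = z • π.path p • t
      rw [← π.triv_mul_path p, mul_smul, smul_smul, e, add_smul, smul_smul, smul_smul,
        h.smul_eq_zero_of_mem_pathFiltration (r := r * π.path p), add_zero, smul_mul_assoc,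
        triv_mul_path]
      rw [add_comm]
      exact π.mul_mem_pathFiltration hr (π.path_mem_pathFiltration le_rfl)
  | succ n ih =>
    intro y hy
    obtain ⟨z, rfl⟩ := Submodule.mem_span_singleton.1 hy
    obtain ⟨c, r, hr, e⟩ := π.exists_mul_triv_eq z (p.trunc (n + 1)).tgt
    obtain ⟨c', hc', e'⟩ := ih (by omega) _ (h.smul_trunc_succ_mem hn hr)
    refine ⟨Pi.single ⟨_, QPath.isRightSubpath_trunc hn⟩ c + c', ?_, ?_⟩
    · intro s hs
      rw [Pi.add_apply, Pi.single_apply] at hs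
      split_ifs at hs with h1
      · rw [h1]
        exact (QPath.length_trunc hn).ge
      · have := hc' s (by simpa using hs)
        omega
    · rw [map_add, add_smul, e', subpathSum_single]
      have e1 : z * π.path (p.trunc (n + 1)) =
          c • π.path (p.trunc (n + 1)) + r * π.path (p.trunc (n + 1)) := by
        have := congrArg (· * π.path (p.trunc (n + 1))) e
        simpa only [mul_assoc, add_mul, smul_mul_assoc, triv_mul_path] using this
      rw [smul_smul z, e1, add_smul, mul_smul r]

/-- Applying an arrow to `u t` leads at least one layer deeper, so only longer subpaths occur. The
trivial path at the end of the arrow removes those that end elsewhere. These are the conditions in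
`IsDetour`. -/
theorem exists_subpathSum_of_cons (h : π.IsTrunk p t) {q : QPath V}
    (hq : ∃ (u : QPath V) (d : V) (α : u.tgt ⟶ d), QPath.IsRightSubpath u p ∧ q = u.cons α) :
    ∃ c : QPath.RightSubpath p → K, (∀ s, c s ≠ 0 → s.1.tgt = q.tgt ∧ q.length ≤ s.1.length) ∧
      π.subpathSum p c • t = π.path q • t := by
  classical
  obtain ⟨u, d, α, hu, rfl⟩ := hq
  have hul := hu.length_le
  obtain ⟨c, hc, e⟩ : ∃ c : QPath.RightSubpath p → K,
      (∀ s, c s ≠ 0 → u.length + 1 ≤ s.1.length) ∧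
        π.subpathSum p c • t = π.path (u.cons α) • t := by
    obtain heq | hlt := hul.eq_or_lt
    · exact ⟨0, by simp, by
        rw [map_zero, zero_smul, h.smul_eq_zero_of_length_lt (by simp [heq])]⟩
    · have hut : u = p.trunc ((p.length - u.length - 1) + 1) := by
        rw [Nat.sub_add_cancel (by omega)]
        exact hu.eq_trunc
      have hm := h.smul_trunc_succ_mem (n := p.length - u.length - 1) (by omega)
        (π.path_mem_pathFiltration (n := 1) (p := ⟨u.tgt, d, Quiver.Hom.toPath α⟩) le_rfl)
      rw [← hut, smul_smul, ← path_cons] at hm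
      obtain ⟨c, hc, e⟩ := h.exists_subpathSum_of_mem (by omega) _ hm
      exact ⟨c, fun s hs => by have := hc s hs; omega, e⟩
  refine ⟨fun s => if s.1.tgt = d then c s else 0, ?_, ?_⟩
  · intro s hs
    simp only [ne_eq, ite_eq_right_iff, Classical.not_imp] at hs
    exact ⟨hs.1, hc s hs.2⟩
  · have e1 : π.path (QPath.triv d) * π.path (u.cons α) = π.path (u.cons α) :=
      π.triv_mul_path (u.cons α)
    rw [← e1, mul_smul, ← e, smul_smul]
    congr 1
    rw [subpathSum_apply, subpathSum_apply, Finset.mul_sum]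
    refine Finset.sum_congr rfl fun s _ => ?_
    rw [mul_smul_comm]
    split_ifs with hs
    · subst hs
      rw [triv_mul_path]
    · rw [π.triv_mul_path_of_ne hs, zero_smul, smul_zero]

end IsTrunk

/-- `k` is the coordinate string of the module generated by `t`, relative to the mast `p`. -/
def IsCoordinates {p : QPath V} {T : Type x} [AddCommGroup T] [Module Λ T] (t : T)
    (k : QPath.DetourIndex p → K) : Prop :=
  ∀ (u : QPath V) (d : V) (α : u.tgt ⟶ d), QPath.IsRightSubpath u p →
    π.path (u.cons α) • t =
      π.subpathSum p (fun s => QPath.stepEntry p k (u.cons α) s.1) • t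

theorem subpathSum_stepEntry_of_isRightSubpath {p q : QPath V} (k : QPath.DetourIndex p → K)
    (hq : QPath.IsRightSubpath q p) :
    π.subpathSum p (fun s => QPath.stepEntry p k q s.1) = π.path q := by
  classical
  rw [subpathSum_apply, Finset.sum_eq_single ⟨q, hq⟩]
  · simp [QPath.stepEntry, hq]
  · intro s _ hs
    have : s.1 ≠ q := fun h => hs (Subtype.ext h)
    simp [QPath.stepEntry, hq, this]
  · simp

theorem IsTrunk.exists_isCoordinates {π : SplitPresentation K V Λ} {p : QPath V} {T : Type x}
    [AddCommGroup T] [Module Λ T] {t : T} (h : π.IsTrunk p t) :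
    ∃ k : QPath.DetourIndex p → K, π.IsCoordinates t k := by
  classical
  choose c hc e using fun (q : QPath V) hq => h.exists_subpathSum_of_cons (q := q) hq
  refine ⟨fun d => c d.1.1 d.2.1 ⟨d.1.2, d.2.2.2.1⟩, fun u d α hu => ?_⟩
  by_cases hq : QPath.IsRightSubpath (u.cons α) p
  · rw [π.subpathSum_stepEntry_of_isRightSubpath _ hq]
  · have hex : ∃ (u' : QPath V) (d' : V) (α' : u'.tgt ⟶ d'),
        QPath.IsRightSubpath u' p ∧ u.cons α = u'.cons α' := ⟨u, d, α, hu, rfl⟩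
    rw [← e _ hex]
    congr 2
    funext s
    rw [QPath.stepEntry, if_neg hq]
    split_ifs with hd
    · rfl
    · by_contra h0
      obtain ⟨h1, h2⟩ := hc _ hex s h0
      exact hd ⟨hex, hq, s.2, h1, h2⟩

namespace IsCoordinates

variable {π} {p : QPath V} {T : Type x} [AddCommGroup T] [Module Λ T] {t : T}
  {k : QPath.DetourIndex p → K}

theorem subpathSum_mulVec {ι : Type*} [Fintype ι] (A : Matrix (QPath.RightSubpath p) ι K)
    (v : ι → K) :
    π.subpathSum p (A.mulVec v) = ∑ u, v u • π.subpathSum p (fun s => A s u) := by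
  have : A.mulVec v = ∑ u, v u • (fun s => A s u) := by
    funext s
    simp [Matrix.mulVec, dotProduct, mul_comm]
  rw [this, map_sum]
  simp

theorem arrow_smul (hk : π.IsCoordinates t k) {c d : V} (α : c ⟶ d)
    (v : QPath.RightSubpath p → K) :
    π.path ⟨c, d, Quiver.Hom.toPath α⟩ • π.subpathSum p v • t =
      π.subpathSum p ((QPath.arrowMatrix p k α).mulVec v) • t := by
  rw [subpathSum_mulVec, smul_smul, subpathSum_apply, Finset.mul_sum, Finset.sum_smul,
    Finset.sum_smul]
  refine Finset.sum_congr rfl fun u _ => ?_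
  rw [mul_smul_comm, smul_smul_eq_algebraMap_smul, smul_smul_eq_algebraMap_smul]
  congr 1
  by_cases hc : c = u.1.tgt
  · subst hc
    rw [← path_cons, hk _ _ _ u.2]
    simp [QPath.arrowMatrix]
  · rw [π.path_mul_path_of_ne (fun h => hc h.symm)]
    have : (fun s => QPath.arrowMatrix p k α s u) = 0 := by
      funext s
      simp [QPath.arrowMatrix, hc]
    rw [this, map_zero]

theorem path_smul (hk : π.IsCoordinates t k) {a b : V} (q : Quiver.Path a b)
    (v : QPath.RightSubpath p → K) :
    π.path ⟨a, b, q⟩ • π.subpathSum p v • t =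
      π.subpathSum p ((QPath.pathMatrix p k q).mulVec v) • t := by
  classical
  induction q with
  | nil =>
    rw [smul_smul]
    congr 1
    rw [subpathSum_apply, subpathSum_apply, Finset.mul_sum]
    refine Finset.sum_congr rfl fun u _ => ?_
    rw [mul_smul_comm]
    simp only [QPath.pathMatrix, Matrix.mulVec_diagonal]
    split_ifs with hu
    · subst hu
      rw [one_mul]
      congr 1
      exact π.triv_mul_path u.1
    · rw [zero_mul, zero_smul]
      have := π.triv_mul_path_of_ne hu
      rw [QPath.triv] at this
      rw [this, smul_zero]
  | @cons b c q α ih =>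
    have e : π.path ⟨a, c, q.cons α⟩ = π.path ⟨b, c, Quiver.Hom.toPath α⟩ * π.path ⟨a, b, q⟩ :=
      π.path_cons ⟨a, b, q⟩ α
    rw [e, mul_smul, ih, hk.arrow_smul, QPath.pathMatrix, Matrix.mulVec_mulVec]

/-- The map from `M_p(k)` that sends `b_u` to `u t` is compatible with the action of the path
algebra. -/
theorem toAlgHom_smul (hk : π.IsCoordinates t k) (z : PathAlgebra K V)
    (v : QPath.RightSubpath p → K) :
    π.toAlgHom z • π.subpathSum p v • t =
      π.subpathSum p ((QPath.algebraMatrix p k z).mulVec v) • t := by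
  rw [toAlgHom_eq_sum, QPath.algebraMatrix]
  simp only [Finsupp.sum]
  rw [Finset.sum_smul, Matrix.sum_mulVec, map_sum, Finset.sum_smul]
  refine Finset.sum_congr rfl fun q _ => ?_
  rw [Matrix.smul_mulVec, map_smul, smul_smul_eq_algebraMap_smul, smul_smul_eq_algebraMap_smul,
    ← hk.path_smul]

theorem mem_uniserialVariety (hk : π.IsCoordinates t k) (h : π.IsTrunk p t) :
    k ∈ π.uniserialVariety p := by
  classical
  intro z hz
  refine Matrix.ext_of_mulVec_single fun u => ?_
  rw [Matrix.zero_mulVec, ← h.subpathSum_smul_eq_zero_iff, ← hk.toAlgHom_smul, hz, zero_smul]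

open Classical in
theorem toAlgHom_smul_eq_zero_iff (hk : π.IsCoordinates t k) (h : π.IsTrunk p t)
    (z : PathAlgebra K V) :
    π.toAlgHom z • t = 0 ↔ (QPath.algebraMatrix p k z).mulVec
      (Pi.single ⟨QPath.triv p.src, p.isRightSubpath_triv_src⟩ 1) = 0 := by
  rw [← h.subpathSum_smul_eq_zero_iff, ← hk.toAlgHom_smul, subpathSum_single, one_smul,
    h.triv_smul]

/-- Whether an element kills `t` is read off from the column of its matrix at the trivial path, and
this matrix depends only on `p` and `k`. -/
theorem ker_toSpanSingleton_eq (hk : π.IsCoordinates t k) (h : π.IsTrunk p t) {T' : Type x}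
    [AddCommGroup T'] [Module Λ T'] {t' : T'} (hk' : π.IsCoordinates t' k) (h' : π.IsTrunk p t') :
    LinearMap.ker (LinearMap.toSpanSingleton Λ T t) =
      LinearMap.ker (LinearMap.toSpanSingleton Λ T' t') := by
  ext y
  obtain ⟨z, rfl⟩ := π.surjective y
  simp only [LinearMap.mem_ker, LinearMap.toSpanSingleton_apply]
  rw [hk.toAlgHom_smul_eq_zero_iff h, hk'.toAlgHom_smul_eq_zero_iff h']

end IsCoordinates

/-! ### Finitely many trunks -/

/-- The pairs of a left ideal `𝔞` and a path `p` such that `𝔞` is the annihilator of a top element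
of a uniserial module with mast `p`. -/
def trunkPairs : Set (Submodule Λ Λ × QPath V) :=
  {z | ∃ (T : ModuleCat.{x} Λ) (t : T), π.IsTrunk z.2 t ∧
    LinearMap.ker (LinearMap.toSpanSingleton Λ T t) = z.1}

theorem exists_length_lt_of_isTrunk : ∃ N : ℕ, ∀ (p : QPath V) (T : ModuleCat.{x} Λ) (t : T),
    π.IsTrunk p t → p.length < N := by
  obtain ⟨N, hN⟩ := π.exists_pow_le
  refine ⟨N, fun p T t h => ?_⟩
  by_contra hlt
  apply h.smul_ne_zero
  rw [path, hN p (not_lt.1 hlt), zero_smul]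

/-- A pair is recovered from its mast and one coordinate string, and the masts have bounded length.
The family `W` covers both hypotheses of the theorem: it is `V_p` in one case and the zero string
alone in the other. -/
theorem finite_trunkPairs_of [∀ a b : V, Finite (a ⟶ b)]
    (W : ∀ p : QPath V, Set (QPath.DetourIndex p → K)) (hW : ∀ p, (W p).Finite)
    (hc : ∀ (p : QPath V) (T : ModuleCat.{x} Λ) (t : T), π.IsTrunk p t →
      ∃ k ∈ W p, π.IsCoordinates t k) : π.trunkPairs.Finite := by
  classical
  obtain ⟨N, hN⟩ := π.exists_length_lt_of_isTrunk
  have hfin : (⋃ p ∈ {p : QPath V | p.length < N},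
      (Sigma.mk p '' W p : Set (Σ p : QPath V, QPath.DetourIndex p → K))).Finite :=
    (QPath.finite_length_lt N).biUnion fun p _ => (hW p).image _
  have hex : ∀ z ∈ π.trunkPairs, ∃ k ∈ W z.2, ∃ (T : ModuleCat.{x} Λ) (t : T), π.IsTrunk z.2 t ∧
      LinearMap.ker (LinearMap.toSpanSingleton Λ T t) = z.1 ∧ π.IsCoordinates t k := by
    rintro z ⟨T, t, h, e⟩
    obtain ⟨k, hk, hkt⟩ := hc _ T t h
    exact ⟨k, hk, T, t, h, e, hkt⟩
  choose! k hk T t ht e hkt using hex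
  refine Set.Finite.of_injOn (f := fun z => (⟨z.2, k z⟩ : Σ p : QPath V, QPath.DetourIndex p → K))
    ?_ ?_ hfin
  · intro z hz
    exact Set.mem_biUnion (hN _ _ _ (ht z hz)) ⟨_, hk z hz, rfl⟩
  · intro z hz z' hz' heq
    injection heq with h1 h2
    have hz1 : z'.2 = z.2 := h1.symm
    refine Prod.ext ?_ h1
    rw [← e z hz, ← e z' hz']
    obtain ⟨a', p'⟩ := z'
    dsimp only at hz1
    subst hz1
    have h3 := hkt _ hz'
    rw [← eq_of_heq h2] at h3
    exact (hkt z hz).ker_toSpanSingleton_eq (ht z hz) h3 (ht _ hz')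

end SplitPresentation

/-! ### Uniqueness of masts under either hypothesis -/

namespace QPath

variable {V : Type u} [Quiver.{v} V] {K : Type w} [Field K]

theorem le_length_of_stepEntry_ne_zero {p q s : QPath V} {k : DetourIndex p → K}
    (h : stepEntry p k q s ≠ 0) : q.length ≤ s.length := by
  classical
  rw [stepEntry] at h
  split_ifs at h with h1 h2 h3
  · rw [h2]
  · exact absurd rfl h
  · exact h3.2.2.2.2
  · exact absurd rfl h

theorem le_length_of_pathMatrix_ne_zero {p : QPath V} {k : DetourIndex p → K} {a b : V}
    (q : Quiver.Path a b) : ∀ {s u : RightSubpath p}, pathMatrix p k q s u ≠ 0 →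
      u.1.length + q.length ≤ s.1.length := by
  classical
  induction q with
  | nil =>
    intro s u h
    rw [pathMatrix, Matrix.diagonal_apply] at h
    split_ifs at h with h1
    · simp [h1]
    · exact absurd rfl h
    · exact absurd rfl h
  | cons q α ih =>
    intro s u h
    rw [pathMatrix, Matrix.mul_apply] at h
    obtain ⟨r, -, hr⟩ := Finset.exists_ne_zero_of_sum_ne_zero h
    have h1 := ih (right_ne_zero_of_mul hr)
    have h2 := left_ne_zero_of_mul hr
    simp only [arrowMatrix, Matrix.of_apply] at h2
    split_ifs at h2 with hc
    · have := le_length_of_stepEntry_ne_zero h2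
      simp only [length_cons] at this
      simp only [Quiver.Path.length_cons]
      omega
    · exact absurd rfl h2

end QPath

namespace SplitPresentation

variable {K : Type w} [Field K] {V : Type u} [Quiver.{v} V] [Fintype V] {Λ : Type x} [Ring Λ]
  [Algebra K Λ] (π : SplitPresentation K V Λ)

/-- Paths of length at least two act as zero on `M_p(k)`, and `I` involves no other paths, so no
equations remain. -/
theorem mem_uniserialVariety_of_length_le_one {p : QPath V} (hp : p.length ≤ 1)
    (k : QPath.DetourIndex p → K) : k ∈ π.uniserialVariety p := by
  intro z hz
  rw [QPath.algebraMatrix]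
  refine Finset.sum_eq_zero fun q hq => ?_
  have h2 := π.ker_le z hz q hq
  have : QPath.pathMatrix p k q.path = 0 := by
    ext s u
    by_contra h
    have h3 := QPath.le_length_of_pathMatrix_ne_zero q.path h
    have h4 := s.2.length_le
    rw [QPath.length] at h2
    omega
  simp only [this, smul_zero]

/-- If all the varieties of uniserial modules are finite over an infinite field, then the quiver
has no parallel arrows. -/
theorem subsingleton_hom [Infinite K] (h : ∀ p : QPath V, (π.uniserialVariety p).Finite)
    (a b : V) : Subsingleton (a ⟶ b) := by
  refine ⟨fun α β => ?_⟩
  by_contra hne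
  set p : QPath V := ⟨a, b, Quiver.Hom.toPath α⟩ with hp
  set q : QPath V := ⟨a, b, Quiver.Hom.toPath β⟩ with hq
  -- The second arrow is a detour on the first, so the affine space containing `V_p` has positive
  -- dimension.
  have hd : QPath.IsDetour p q p := by
    refine ⟨⟨QPath.triv a, b, β, p.isRightSubpath_triv_src, rfl⟩, fun hr => hne ?_,
      p.isRightSubpath_refl, rfl, le_rfl⟩
    have := hr.eq_of_length_eq p.isRightSubpath_refl rfl
    rw [hp, hq] at this
    injection this with h1 h2 h3
    have h4 := Quiver.Path.hom_heq_of_cons_eq_cons h3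
    exact (eq_of_heq h4).symm
  have : Nonempty (QPath.DetourIndex p) := ⟨⟨(q, p), hd⟩⟩
  have huniv : π.uniserialVariety p = Set.univ :=
    Set.eq_univ_of_forall (π.mem_uniserialVariety_of_length_le_one le_rfl)
  have hfin := h p
  rw [huniv] at hfin
  exact Set.infinite_univ hfin

/-- Uniserial modules have only one mast. -/
def HasUniqueMasts : Prop :=
  ∀ (p : QPath V) (T : ModuleCat.{x} Λ) (t : T), π.IsTrunk p t → ∀ q : QPath V,
    q.length = p.length → π.path q • t ≠ 0 → q = p

variable {π}

/-- Induction along `q = β u`, where `u` is already a right subpath of `p`. If `q` is not one, then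
`q t` is a combination of elements `s t` with `s` at least as long as `q`, and `y` kills those with
`s` longer. So some `s` of the length of `q` occurs. It has the form `γ u` with `γ` parallel to `β`,
whence `γ = β`, a contradiction. -/
theorem isRightSubpath_of_smul_ne_zero (hs : ∀ a b : V, Subsingleton (a ⟶ b)) {p : QPath V}
    {T : Type x} [AddCommGroup T] [Module Λ T] {t : T} (h : π.IsTrunk p t) (q : QPath V) :
    ∀ (y : QPath V), y.length + q.length = p.length → (π.path y * π.path q) • t ≠ 0 →
      QPath.IsRightSubpath q p := by
  obtain ⟨k, hk⟩ := h.exists_isCoordinates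
  obtain ⟨a, b, q⟩ := q
  induction q with
  | nil =>
    intro y _ hy
    by_cases hsrc : p.src = a
    · subst hsrc
      exact p.isRightSubpath_triv_src
    · rw [mul_smul, h.path_smul_of_src_ne hsrc, smul_zero] at hy
      exact absurd rfl hy
  | @cons b c q β ih =>
    intro y hy hne
    have e : π.path ⟨a, c, q.cons β⟩ = π.path ⟨b, c, Quiver.Hom.toPath β⟩ * π.path ⟨a, b, q⟩ :=
      π.path_cons ⟨a, b, q⟩ β
    have hu : QPath.IsRightSubpath ⟨a, b, q⟩ p := by
      rw [e, ← mul_assoc] at hne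
      obtain h0 | ⟨r, hr, -, -, hr'⟩ := π.path_mul_path_cases y ⟨b, c, Quiver.Hom.toPath β⟩
      · rw [h0, zero_mul, zero_smul] at hne
        exact absurd rfl hne
      · rw [hr'] at hne
        refine ih r ?_ hne
        simp only [QPath.length, Quiver.Path.length_cons, Quiver.Path.length_toPath] at hy hr ⊢
        omega
    by_contra hnot
    change ¬ QPath.IsRightSubpath (QPath.cons ⟨a, b, q⟩ β) p at hnot
    have hc : π.path ⟨a, c, q.cons β⟩ • t = _ := hk ⟨a, b, q⟩ c β hu
    rw [mul_smul, hc, smul_smul, subpathSum_apply, Finset.mul_sum, Finset.sum_smul] at hne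
    obtain ⟨s, -, hs0⟩ := Finset.exists_ne_zero_of_sum_ne_zero hne
    rw [mul_smul_comm] at hs0
    have h1 : QPath.stepEntry p k (QPath.cons ⟨a, b, q⟩ β) s.1 ≠ 0 := by
      intro h0
      rw [h0, zero_smul, zero_smul] at hs0
      exact hs0 rfl
    have h2 : QPath.IsDetour p (QPath.cons ⟨a, b, q⟩ β) s.1 := by
      rw [QPath.stepEntry, if_neg hnot] at h1
      split_ifs at h1 with h2
      · exact h2
      · exact absurd rfl h1
    have h3 : s.1.length ≤ (⟨a, c, q.cons β⟩ : QPath V).length := by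
      obtain h0 | ⟨r, hr, -, -, hr'⟩ := π.path_mul_path_cases y s.1
      · rw [h0, smul_zero, zero_smul] at hs0
        exact absurd rfl hs0
      · by_contra hlt
        rw [hr', smul_smul_eq_algebraMap_smul, h.smul_eq_zero_of_length_lt (by omega),
          smul_zero] at hs0
        exact hs0 rfl
    obtain ⟨⟨a', c', s⟩, hsp⟩ := s
    obtain rfl : c' = c := h2.2.2.2.1
    have h4 := h2.2.2.2.2
    cases s with
    | nil => simp [QPath.length, QPath.cons] at h4
    | @cons b' _ s γ =>
      have hs' : QPath.IsRightSubpath ⟨a', b', s⟩ p :=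
        QPath.IsRightSubpath.of_cons (u := ⟨a', b', s⟩) (α := γ) hsp
      have := hs'.eq_of_length_eq hu (by
        simp only [QPath.length, QPath.cons, Quiver.Path.length_cons] at h3 h4 ⊢
        omega)
      injection this with e1 e2 e3
      subst e1 e2
      obtain rfl := eq_of_heq e3
      rw [(hs b' c').elim γ β] at hsp
      exact hnot hsp

theorem hasUniqueMasts_of_subsingleton_hom (hs : ∀ a b : V, Subsingleton (a ⟶ b)) :
    π.HasUniqueMasts := by
  intro p T t h q hl hq
  have := isRightSubpath_of_smul_ne_zero hs h q (QPath.triv q.tgt) (by simpa using hl)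
    (by rwa [triv_mul_path])
  exact this.eq_of_length_eq p.isRightSubpath_refl hl

theorem IsTrunk.smul_eq_zero_of_edgePaths (he : π.UniserialGraphsAreEdgePaths) {p : QPath V}
    {T : ModuleCat.{x} Λ} {t : T} (h : π.IsTrunk p t) {q : QPath V}
    (hq : ¬ QPath.IsRightSubpath q p) : π.path q • t = 0 := by
  by_cases hsrc : p.src = q.src
  · exact he T p t h.uniserial h.mast h.isTopElementOfType q hsrc.symm hq
  · exact h.path_smul_of_src_ne hsrc

theorem hasUniqueMasts_of_edgePaths (he : π.UniserialGraphsAreEdgePaths) :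
    π.HasUniqueMasts := by
  intro p T t h q hl hq
  have : QPath.IsRightSubpath q p := by
    by_contra hnot
    exact hq (h.smul_eq_zero_of_edgePaths he hnot)
  exact this.eq_of_length_eq p.isRightSubpath_refl hl

theorem isCoordinates_zero_of_edgePaths (he : π.UniserialGraphsAreEdgePaths) {p : QPath V}
    {T : ModuleCat.{x} Λ} {t : T} (h : π.IsTrunk p t) :
    π.IsCoordinates t (0 : QPath.DetourIndex p → K) := by
  intro u d α hu
  by_cases hq : QPath.IsRightSubpath (u.cons α) p
  · rw [π.subpathSum_stepEntry_of_isRightSubpath _ hq]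
  · rw [h.smul_eq_zero_of_edgePaths he hq]
    have : (fun s : QPath.RightSubpath p => QPath.stepEntry p (0 : QPath.DetourIndex p → K)
        (u.cons α) s.1) = 0 := by
      funext s
      simp [QPath.stepEntry, hq]
    rw [this, map_zero, zero_smul]

theorem hasUniqueMasts_and_finite_trunkPairs [∀ a b : V, Finite (a ⟶ b)]
    (h : (Infinite K ∧ ∀ p : QPath V, (π.uniserialVariety p).Finite) ∨
      π.UniserialGraphsAreEdgePaths) : π.HasUniqueMasts ∧ π.trunkPairs.Finite := by
  obtain ⟨_, hV⟩ | he := h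
  · refine ⟨hasUniqueMasts_of_subsingleton_hom (π.subsingleton_hom hV),
      π.finite_trunkPairs_of (fun p => π.uniserialVariety p) hV fun p T t ht => ?_⟩
    obtain ⟨k, hk⟩ := ht.exists_isCoordinates
    exact ⟨k, hk.mem_uniserialVariety ht, hk⟩
  · exact ⟨hasUniqueMasts_of_edgePaths he, π.finite_trunkPairs_of (fun p => {0})
      (fun p => Set.finite_singleton 0)
      fun p T t ht => ⟨0, rfl, isCoordinates_zero_of_edgePaths he ht⟩⟩

end SplitPresentation

/-! ### Gluing cyclic modules, and splitting along a retraction -/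

section Glue

variable {R : Type x} [Ring R] {ι : Type*} [DecidableEq ι]

/-- The relations that make the coordinates of `ι → R` into modules `R ⧸ 𝔞 i` and identify
`y i e` in the coordinate `i` with `y j e` in the coordinate `j` for all `e ≤ d i j`. -/
def glueRel (𝔞 : ι → Submodule R R) (y : ι → ℕ → R) (d : ι → ι → ℕ) : Submodule R (ι → R) :=
  Submodule.span R ({f | ∃ i, ∃ a ∈ 𝔞 i, Pi.single i a = f} ∪
    {f | ∃ i j e, e ≤ d i j ∧ Pi.single i (y i e) - Pi.single j (y j e) = f})

/-- The module obtained from the cyclic modules `R ⧸ 𝔞 i` by gluing. -/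
abbrev Glue (𝔞 : ι → Submodule R R) (y : ι → ℕ → R) (d : ι → ι → ℕ) : Type _ :=
  (ι → R) ⧸ glueRel 𝔞 y d

namespace Glue

variable {𝔞 : ι → Submodule R R} {y : ι → ℕ → R} {d : ι → ι → ℕ}

theorem single_mem {i : ι} {a : R} (ha : a ∈ 𝔞 i) : Pi.single i a ∈ glueRel 𝔞 y d :=
  Submodule.subset_span (Or.inl ⟨i, a, ha, rfl⟩)

theorem single_sub_single_mem {i j : ι} {e : ℕ} (he : e ≤ d i j) :
    Pi.single i (y i e) - Pi.single j (y j e) ∈ glueRel 𝔞 y d :=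
  Submodule.subset_span (Or.inr ⟨i, j, e, he, rfl⟩)

theorem glueRel_le {A : Submodule R (ι → R)} (h₁ : ∀ i, ∀ a ∈ 𝔞 i, Pi.single i a ∈ A)
    (h₂ : ∀ i j e, e ≤ d i j → Pi.single i (y i e) - Pi.single j (y j e) ∈ A) :
    glueRel 𝔞 y d ≤ A := by
  refine Submodule.span_le.2 ?_
  rintro _ (⟨i, a, ha, rfl⟩ | ⟨i, j, e, he, rfl⟩)
  · exact h₁ i a ha
  · exact h₂ i j e he

variable (𝔞 y d) in
/-- The generators of a glued module. -/
def gen (i : ι) : Glue 𝔞 y d := (glueRel 𝔞 y d).mkQ (Pi.single i 1)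

theorem smul_gen (i : ι) (a : R) : a • gen 𝔞 y d i = (glueRel 𝔞 y d).mkQ (Pi.single i a) := by
  rw [gen, ← map_smul, ← Pi.single_smul, smul_eq_mul, mul_one]

theorem smul_gen_eq_zero {i : ι} {a : R} (ha : a ∈ 𝔞 i) : a • gen 𝔞 y d i = 0 := by
  rw [smul_gen]
  exact (Submodule.Quotient.mk_eq_zero _).2 (single_mem ha)

theorem smul_gen_eq {i j : ι} {e : ℕ} (he : e ≤ d i j) :
    y i e • gen 𝔞 y d i = y j e • gen 𝔞 y d j := by
  rw [smul_gen, smul_gen]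
  exact (Submodule.Quotient.eq _).2 (single_sub_single_mem he)

variable [Fintype ι] {N : Type*} [AddCommGroup N] [Module R N]

/-- The homomorphism from a glued module with prescribed values at the generators. -/
def lift (n : ι → N) (h₁ : ∀ i, ∀ a ∈ 𝔞 i, a • n i = 0)
    (h₂ : ∀ i j e, e ≤ d i j → y i e • n i = y j e • n j) : Glue 𝔞 y d →ₗ[R] N :=
  (glueRel 𝔞 y d).liftQ (Fintype.linearCombination R n) (glueRel_le
    (fun i a ha => by
      rw [LinearMap.mem_ker, Fintype.linearCombination_apply_single, h₁ i a ha])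
    (fun i j e he => by
      rw [LinearMap.mem_ker, map_sub, Fintype.linearCombination_apply_single,
        Fintype.linearCombination_apply_single, h₂ i j e he, sub_self]))

@[simp]
theorem lift_gen (n : ι → N) (h₁ : ∀ i, ∀ a ∈ 𝔞 i, a • n i = 0)
    (h₂ : ∀ i j e, e ≤ d i j → y i e • n i = y j e • n j) (i : ι) :
    lift n h₁ h₂ (gen 𝔞 y d i) = n i := by
  rw [lift, gen, Submodule.mkQ_apply, Submodule.liftQ_apply,
    Fintype.linearCombination_apply_single, one_smul]

theorem hom_ext {f g : Glue 𝔞 y d →ₗ[R] N} (h : ∀ i, f (gen 𝔞 y d i) = g (gen 𝔞 y d i)) :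
    f = g := by
  refine Submodule.linearMap_qext _ ?_
  refine LinearMap.pi_ext fun i a => ?_
  have : (Pi.single i a : ι → R) = a • Pi.single i 1 := by
    rw [← Pi.single_smul, smul_eq_mul, mul_one]
  rw [this, map_smul, map_smul]
  exact congrArg (a • ·) (h i)

/-- Gluing data that differ by a bijection of the index sets give isomorphic modules. -/
theorem nonempty_equiv_reindex {ι' : Type*} [DecidableEq ι'] [Fintype ι'] (e : ι' ≃ ι) :
    Nonempty (Glue 𝔞 y d ≃ₗ[R]
      Glue (fun i => 𝔞 (e i)) (fun i => y (e i)) (fun i j => d (e i) (e j))) := by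
  refine ⟨LinearEquiv.ofLinearMap
    (lift (fun i => gen _ _ _ (e.symm i)) (fun i a ha => smul_gen_eq_zero (by simpa using ha))
      (fun i j m hm => ?_))
    (lift (fun i => gen _ _ _ (e i)) (fun i a ha => smul_gen_eq_zero ha)
      (fun i j m hm => smul_gen_eq hm))
    (hom_ext fun i => by simp) (hom_ext fun i => by simp)⟩
  have := smul_gen_eq (𝔞 := fun i => 𝔞 (e i)) (y := fun i => y (e i))
    (d := fun i j => d (e i) (e j)) (i := e.symm i) (j := e.symm j) (e := m) (by simpa using hm)
  simpa using this

/-- If a retraction `r` of the index set is compatible with the gluing, then the coordinates that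
are moved by `r` can be split off. -/
theorem nonempty_equiv_prod (r : ι → ι) (g : ℕ) (hr : ∀ i, r (r i) = r i)
    (h𝔞 : ∀ i, 𝔞 (r i) = 𝔞 i) (hy : ∀ i, y (r i) = y i)
    (hd : ∀ i j, r i = r j ∨ d i j ≤ d (r i) (r j))
    (hout : ∀ i j, r i ≠ i → r j = j → d i j ≤ g ∧ d j i ≤ g)
    (hin : ∀ i, r i ≠ i → g ≤ d i (r i))
    (hdiv : ∀ i, r i ≠ i → ∀ e ≤ g, y i e ∈ Submodule.span R {y i g}) :
    Nonempty (Glue 𝔞 y d ≃ₗ[R]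
      Glue (ι := {i // r i = i}) (fun i => 𝔞 i) (fun i => y i) (fun i j => d i j) ×
      Glue (ι := {i // r i ≠ i}) (fun i => 𝔞 i ⊔ Submodule.span R {y i g}) (fun i => y i)
        (fun i j => d i j)) := by
  set G₁ := Glue (ι := {i // r i = i}) (fun i => 𝔞 i) (fun i => y i) (fun i j => d i j)
  set G₂ := Glue (ι := {i // r i ≠ i}) (fun i => 𝔞 i ⊔ Submodule.span R {y i g}) (fun i => y i)
    (fun i j => d i j)
  let g₁ : {i // r i = i} → G₁ := gen _ _ _
  let g₂ : {i // r i ≠ i} → G₂ := gen _ _ _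
  -- Relations are imposed at every depth up to `d i j`, so the inequality `d i j ≤ d (r i) (r j)`
  -- is enough to carry them over.
  have hrel : ∀ i j e, e ≤ d i j →
      y i e • g₁ ⟨r i, hr i⟩ = y j e • g₁ ⟨r j, hr j⟩ := by
    intro i j e he
    obtain h | h := hd i j
    · have : y i = y j := by rw [← hy i, ← hy j, h]
      rw [this]
      congr 2
      exact Subtype.ext h
    · have := smul_gen_eq (𝔞 := fun i : {i // r i = i} => 𝔞 i)
        (y := fun i : {i // r i = i} => y i) (d := fun i j : {i // r i = i} => d i j)
        (i := ⟨r i, hr i⟩) (j := ⟨r j, hr j⟩) (he.trans h)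
      simpa only [hy] using this
  have hrel' : ∀ i j e, e ≤ d i j →
      y i e • gen 𝔞 y d (r i) = y j e • gen 𝔞 y d (r j) := by
    intro i j e he
    obtain h | h := hd i j
    · rw [h, ← hy i, ← hy j, h]
    · have := smul_gen_eq (𝔞 := 𝔞) (y := y) (d := d) (i := r i) (j := r j) (he.trans h)
      rwa [hy, hy] at this
  have hg₂ : ∀ (i : {i // r i ≠ i}) e, e ≤ g → y i e • g₂ i = 0 := fun i e he =>
    smul_gen_eq_zero (Submodule.mem_sup_right (hdiv i i.2 e he))
  -- Moved and fixed coordinates are glued only at depths at most `g`, where the generators of `G₂`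
  -- are killed. Sending the fixed coordinates to zero is thus consistent.
  let F₂ : ι → G₂ := fun i => if h : r i = i then 0 else g₂ ⟨i, h⟩
  have hF₂ : ∀ i j e, e ≤ d i j → y i e • F₂ i = y j e • F₂ j := by
    intro i j e he
    by_cases hi : r i = i <;> by_cases hj : r j = j
    · simp only [F₂, hi, hj, dite_true, smul_zero]
    · simp only [F₂, hi, hj, dite_true, smul_zero, dite_false]
      exact (hg₂ ⟨j, hj⟩ e (he.trans (hout j i hj hi).2)).symm
    · simp only [F₂, hi, hj, dite_true, smul_zero, dite_false]
      exact hg₂ ⟨i, hi⟩ e (he.trans (hout i j hi hj).1)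
    · simp only [F₂, hi, hj, dite_false]
      exact smul_gen_eq (ι := {i // r i ≠ i}) (i := ⟨i, hi⟩) (j := ⟨j, hj⟩) he
  let F : Glue 𝔞 y d →ₗ[R] G₁ × G₂ := lift (fun i => (g₁ ⟨r i, hr i⟩, F₂ i))
    (fun i a ha => by
      refine Prod.ext (smul_gen_eq_zero (by rwa [h𝔞])) ?_
      change a • F₂ i = 0
      by_cases hi : r i = i
      · simp only [F₂, hi, dite_true, smul_zero]
      · simp only [F₂, hi, dite_false]
        exact smul_gen_eq_zero (Submodule.mem_sup_left ha))
    (fun i j e he => Prod.ext (hrel i j e he) (hF₂ i j e he))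
  let H₁ : G₁ →ₗ[R] Glue 𝔞 y d := lift (fun i => gen 𝔞 y d i)
    (fun i a ha => smul_gen_eq_zero ha) (fun i j e he => smul_gen_eq he)
  let H₂ : G₂ →ₗ[R] Glue 𝔞 y d := lift (fun i => gen 𝔞 y d i - gen 𝔞 y d (r i))
    (fun i a ha => by
      obtain ⟨b, hb, c, hc, rfl⟩ := Submodule.mem_sup.1 ha
      obtain ⟨z, rfl⟩ := Submodule.mem_span_singleton.1 hc
      -- The difference `gen i - gen (r i)` satisfies the extra relation of `G₂` because `i` and `r
      -- i` are glued at least to depth `g`.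
      have h1 : y i g • gen 𝔞 y d i = y i g • gen 𝔞 y d (r i) := by
        have := smul_gen_eq (𝔞 := 𝔞) (y := y) (hin i i.2)
        rwa [hy] at this
      rw [add_smul, smul_sub b, smul_gen_eq_zero hb, smul_gen_eq_zero (by rwa [h𝔞]), sub_zero,
        zero_add, smul_eq_mul, mul_smul, smul_sub, h1, sub_self, smul_zero])
    (fun i j e he => by
      rw [smul_sub, smul_sub, smul_gen_eq he, hrel' i j e he])
  have eF : ∀ i, F (gen 𝔞 y d i) = (g₁ ⟨r i, hr i⟩, F₂ i) := lift_gen _ _ _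
  have e₁ : ∀ i, H₁ (g₁ i) = gen 𝔞 y d i := lift_gen _ _ _
  have e₂ : ∀ i, H₂ (g₂ i) = gen 𝔞 y d i - gen 𝔞 y d (r i) := lift_gen _ _ _
  refine ⟨LinearEquiv.ofLinearMap F (H₁.coprod H₂) ?_ ?_⟩
  · refine LinearMap.prod_ext (hom_ext fun i => ?_) (hom_ext fun i => ?_)
    · change F (H₁ (g₁ i) + H₂ 0) = (g₁ i, 0)
      have : F₂ i = 0 := by simp only [F₂, i.2, dite_true]
      rw [map_zero, add_zero, e₁, eF, this]
      congr 2
      exact Subtype.ext i.2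
    · change F (H₁ 0 + H₂ (g₂ i)) = (0, g₂ i)
      have hi : ¬ r i = i := i.2
      have : F₂ i - F₂ (r i) = g₂ i := by
        simp only [F₂, hi, hr, dite_true, dite_false, sub_zero]
      rw [map_zero, zero_add, e₂, map_sub, eF, eF, Prod.mk_sub_mk, this]
      congr 1
      rw [sub_eq_zero]
      congr 1
      exact Subtype.ext (hr i).symm
  · refine hom_ext fun i => ?_
    change (H₁.coprod H₂) (F (gen 𝔞 y d i)) = gen 𝔞 y d i
    rw [eF, LinearMap.coprod_apply, e₁]
    by_cases hi : r i = i
    · simp only [F₂, hi, dite_true, map_zero, add_zero]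
    · simp only [F₂, hi, dite_false]
      rw [e₂]
      abel

end Glue

end Glue

/-! ### Repetitions in large coloured ultrametric spaces -/

section Pigeonhole

/-- The retraction of a finite coloured ultrametric space that moves one ball onto another one;
`N` is the distance (on a reversed scale) of a point to itself. -/
theorem exists_retraction_of_card_ball (N : ℕ) (C : Type*) [Finite C] (k : ℕ) :
    k ≤ N → ∃ L : ℕ, ∀ (n : ℕ) (c : Fin n → C) (d : Fin n → Fin n → ℕ),
      (∀ i j, d i j = d j i) → (∀ i j l, min (d i j) (d j l) ≤ d i l) → (∀ i, d i i = N) →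
      (∀ i j, i ≠ j → d i j < N) → ∀ i₀ : Fin n,
      L < (Finset.univ.filter fun j => N - k ≤ d i₀ j).card →
      ∃ (r : Fin n → Fin n) (g : ℕ), (∀ i, r (r i) = r i) ∧ (∀ i, c (r i) = c i) ∧
        (∀ i j, r i = r j ∨ d i j ≤ d (r i) (r j)) ∧
        (∀ i j, r i ≠ i → r j = j → d i j ≤ g) ∧
        (∀ i, r i ≠ i → g ≤ d i (r i)) ∧
        (∀ i j, r i ≠ i → r j ≠ j → g < d i j) ∧ ∃ i, r i ≠ i := by
  classical
  induction k with
  | zero =>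
    intro _
    -- A ball of level `N` is a single point, so the bound `1` is never exceeded.
    refine ⟨1, fun n c d _ _ _ hlt i₀ hcard => ?_⟩
    exfalso
    have : (Finset.univ.filter fun j => N - 0 ≤ d i₀ j) ⊆ {i₀} := by
      intro j hj
      rw [Finset.mem_filter] at hj
      rw [Finset.mem_singleton]
      by_contra hne
      have := hlt i₀ j (Ne.symm hne)
      omega
    have := Finset.card_le_card this
    rw [Finset.card_singleton] at this
    omega
  | succ k ih =>
    intro hk
    obtain ⟨L, hL⟩ := ih (by omega)
    -- The isometry types, with colours and a numbering, of spaces with at most `L` points.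
    let Code := Σ m : Fin (L + 1), (Fin m → C) × (Fin m → Fin m → Fin (N + 1))
    have : Fintype Code := Fintype.ofFinite _
    refine ⟨Fintype.card Code * L, fun n c d hsymm hultra hdiag hlt i₀ hcard => ?_⟩
    set h := N - (k + 1) with hh
    have hh1 : N - k = h + 1 := by omega
    rw [hh1] at hL
    have hleN : ∀ i j, d i j ≤ N := fun i j => by
      by_cases hij : i = j
      · rw [hij, hdiag]
      · exact (hlt i j hij).le
    -- Either a ball of the next finer level is already too large and the induction hypothesis
    -- applies, or all those balls have codes.
    by_cases hbig : ∃ j, L < (Finset.univ.filter fun l => h + 1 ≤ d j l).card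
    · obtain ⟨j, hj⟩ := hbig
      exact hL n c d hsymm hultra hdiag hlt j hj
    push Not at hbig
    let B : Fin n → Type := fun j => {l // h + 1 ≤ d j l}
    have hBcard : ∀ j, Fintype.card (B j) ≤ L := fun j => by
      rw [Fintype.card_subtype]
      exact hbig j
    let m : Fin n → Fin (L + 1) := fun j => ⟨Fintype.card (B j), Nat.lt_succ_of_le (hBcard j)⟩
    let e : ∀ j, Fin (m j) ≃ B j := fun j => (Fintype.equivFin (B j)).symm
    let code : Fin n → Code := fun j => ⟨m j, fun a => c (e j a).1, fun a b =>
      ⟨d (e j a).1 (e j b).1, Nat.lt_succ_of_le (hleN _ _)⟩⟩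
    have hcode : ∀ j j', code j = code j' → ∃ φ : B j' ≃ B j,
        (∀ a, c (φ a).1 = c a.1) ∧ ∀ a b, d (φ a).1 (φ b).1 = d a.1 b.1 := by
      intro j j' hjj
      have key : ∀ (m₁ m₂ : Fin (L + 1)) (e₁ : Fin m₁ ≃ B j) (e₂ : Fin m₂ ≃ B j'),
          (⟨m₁, fun a => c (e₁ a).1, fun a b =>
            ⟨d (e₁ a).1 (e₁ b).1, Nat.lt_succ_of_le (hleN _ _)⟩⟩ : Code) =
          ⟨m₂, fun a => c (e₂ a).1, fun a b =>
            ⟨d (e₂ a).1 (e₂ b).1, Nat.lt_succ_of_le (hleN _ _)⟩⟩ →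
          ∃ φ : B j' ≃ B j,
            (∀ a, c (φ a).1 = c a.1) ∧ ∀ a b, d (φ a).1 (φ b).1 = d a.1 b.1 := by
        intro m₁ m₂ e₁ e₂ heq
        injection heq with h1 h2
        subst h1
        have h3 := eq_of_heq h2
        rw [Prod.mk.injEq] at h3
        refine ⟨e₂.symm.trans e₁, fun a => ?_, fun a b => ?_⟩
        · have := congrFun h3.1 (e₂.symm a)
          simpa using this
        · have := congrFun (congrFun h3.2 (e₂.symm a)) (e₂.symm b)
          simpa using this
      exact key _ _ (e j) (e j') hjj
    -- More than `L` centres share a code, whereas the fine ball around one of them has at most `L`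
    -- points. So another centre with the same code lies outside that ball.
    obtain ⟨y, -, hy⟩ := Finset.exists_lt_card_fiber_of_mul_lt_card_of_maps_to
      (s := Finset.univ.filter fun j => h ≤ d i₀ j) (t := (Finset.univ : Finset Code)) (f := code)
      (n := L) (fun _ _ => Finset.mem_univ _) (by rwa [Finset.card_univ])
    obtain ⟨j, hj⟩ := Finset.card_pos.1 (Nat.zero_lt_of_lt hy)
    obtain ⟨j', hj', hjj'⟩ := Finset.exists_mem_notMem_of_card_lt_card
      (lt_of_le_of_lt (hbig j) hy)
    simp only [Finset.mem_filter, Finset.mem_univ, true_and, not_le] at hj hj' hjj'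
    obtain ⟨φ, hφc, hφd⟩ := hcode j j' (hj.2.trans hj'.2.symm)
    have hjj : h ≤ d j j' := by
      refine le_trans ?_ (hultra j i₀ j')
      rw [hsymm j i₀]
      exact le_min hj.1 hj'.1
    -- Between two different fine balls inside one ball of level `h`, the value of `d` is exactly
    -- `h`.
    have hcross : ∀ b b', h + 1 ≤ d j b → h + 1 ≤ d j' b' → h ≤ d b b' ∧ d b b' < h + 1 := by
      intro b b' hb hb'
      have h1 := hultra b j j'
      have h2 := hultra b j' b'
      have h3 := hultra j b b'
      have h4 := hultra j b' j'
      rw [hsymm b j] at h1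
      rw [hsymm b' j'] at h4
      omega
    -- Fold the ball of `j'` onto the ball of `j` and fix everything else.
    let r : Fin n → Fin n := fun i => if hi : h + 1 ≤ d j' i then (φ ⟨i, hi⟩).1 else i
    have hrpos : ∀ i (hi : h + 1 ≤ d j' i), r i = (φ ⟨i, hi⟩).1 := fun i hi => dif_pos hi
    have hrneg : ∀ i, ¬ h + 1 ≤ d j' i → r i = i := fun i hi => dif_neg hi
    have hball : ∀ b, h + 1 ≤ d j b → ¬ h + 1 ≤ d j' b := by
      intro b hb hb'
      have := hcross b b hb hb'
      have h1 := hdiag b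
      have h2 := hultra j b j'
      rw [hsymm b j'] at h2
      omega
    have hmoved : ∀ i, r i ≠ i → h + 1 ≤ d j' i := fun i hi => by
      by_contra hnot
      exact hi (hrneg i hnot)
    have hfixed : ∀ i, r i = i → ¬ h + 1 ≤ d j' i := fun i hi hpos => by
      rw [hrpos i hpos] at hi
      have h1 := hball _ (φ ⟨i, hpos⟩).2
      rw [hi] at h1
      exact h1 hpos
    refine ⟨r, h, fun i => ?_, fun i => ?_, fun i l => ?_, fun i l hi hl => ?_, fun i hi => ?_,
      fun i l hi hl => ?_, j', fun hr => hfixed j' hr (by rw [hdiag]; omega)⟩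
    · by_cases hi : h + 1 ≤ d j' i
      · rw [hrpos i hi]
        exact hrneg _ (hball _ (φ ⟨i, hi⟩).2)
      · rw [hrneg i hi, hrneg i hi]
    · by_cases hi : h + 1 ≤ d j' i
      · rw [hrpos i hi, hφc]
      · rw [hrneg i hi]
    · have hmix : ∀ i l (hi : h + 1 ≤ d j' i), ¬ h + 1 ≤ d j' l → d i l ≤ d (φ ⟨i, hi⟩).1 l := by
        intro i l hi hl
        have h1 := (hcross _ i (φ ⟨i, hi⟩).2 hi).1
        have h2 := hultra (φ ⟨i, hi⟩).1 i l
        have h3 := hultra j' i l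
        omega
      by_cases hi : h + 1 ≤ d j' i <;> by_cases hl : h + 1 ≤ d j' l
      · rw [hrpos i hi, hrpos l hl]
        exact Or.inr (hφd ⟨i, hi⟩ ⟨l, hl⟩).ge
      · rw [hrpos i hi, hrneg l hl]
        exact Or.inr (hmix i l hi hl)
      · rw [hrneg i hi, hrpos l hl, hsymm i l, hsymm i]
        exact Or.inr (hmix l i hl hi)
      · rw [hrneg i hi, hrneg l hl]
        exact Or.inr le_rfl
    · have h1 := hmoved i hi
      have h2 := hfixed l hl
      have h3 := hultra j' i l
      omega
    · rw [hrpos i (hmoved i hi), hsymm]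
      exact (hcross _ i (φ ⟨i, hmoved i hi⟩).2 (hmoved i hi)).1
    · have h1 := hmoved i hi
      have h2 := hmoved l hl
      have h3 := hultra i j' l
      rw [hsymm i j'] at h3
      omega

end Pigeonhole

/-! ### Saguaros as glued modules -/

/-- A sequence of gluing depths for consecutive indices extends to all pairs of indices. -/
theorem exists_gluing_depths {m : ℕ} (N : ℕ) (ε : Fin m → ℕ) (hε : ∀ k, ε k < N) :
    ∃ d : Fin (m + 1) → Fin (m + 1) → ℕ, (∀ i j, d i j = d j i) ∧
      (∀ i j l, min (d i j) (d j l) ≤ d i l) ∧ (∀ i, d i i = N) ∧ (∀ i j, i ≠ j → d i j < N) ∧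
      (∀ i j k l, i ≤ k → k < l → l ≤ j → d i j ≤ d k l) ∧
      ∀ k : Fin m, d k.castSucc k.succ = ε k := by
  classical
  -- `d i j` is the minimum of `N` and the depths of the steps between `i` and `j`. For `i = j`
  -- there is no step and the value is `N`.
  let P : Fin (m + 1) → Fin (m + 1) → ℕ → Prop := fun i j e =>
    ∀ k : Fin m, (i.1 ≤ k.1 ∧ k.1 < j.1) ∨ (j.1 ≤ k.1 ∧ k.1 < i.1) → e ≤ ε k
  let d : Fin (m + 1) → Fin (m + 1) → ℕ := fun i j => Nat.findGreatest (P i j) N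
  have hd : ∀ i j e, e ≤ d i j ↔ e ≤ N ∧ P i j e := by
    intro i j e
    refine ⟨fun h => ⟨h.trans (Nat.findGreatest_le N), fun k hk => ?_⟩,
      fun h => Nat.le_findGreatest h.1 h.2⟩
    have h0 : P i j 0 := fun k _ => Nat.zero_le _
    exact h.trans (Nat.findGreatest_spec (P := P i j) (Nat.zero_le N) h0 k hk)
  have hle : ∀ i j i' j', (∀ e, e ≤ N → P i j e → P i' j' e) → d i j ≤ d i' j' := by
    intro i j i' j' h
    have := (hd i j (d i j)).1 le_rfl
    exact (hd i' j' _).2 ⟨this.1, h _ this.1 this.2⟩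
  refine ⟨d, fun i j => ?_, fun i j l => ?_, fun i => ?_, fun i j hij => ?_,
    fun i j k l hik hkl hlj => ?_, fun k => ?_⟩
  · exact le_antisymm (hle _ _ _ _ fun e _ h k hk => h k hk.symm)
      (hle _ _ _ _ fun e _ h k hk => h k hk.symm)
  · have h1 := (hd i j _).1 (min_le_left (d i j) (d j l))
    have h2 := (hd j l _).1 (min_le_right (d i j) (d j l))
    refine (hd i l _).2 ⟨h1.1, fun k hk => ?_⟩
    by_cases hc : (i.1 ≤ k.1 ∧ k.1 < j.1) ∨ (j.1 ≤ k.1 ∧ k.1 < i.1)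
    · exact h1.2 k hc
    · exact h2.2 k (by omega)
  · refine le_antisymm ((hd i i _).1 le_rfl).1 ((hd i i N).2 ⟨le_rfl, fun k hk => ?_⟩)
    omega
  · have hij' : i.1 ≠ j.1 := fun h => hij (Fin.ext h)
    have hi := i.2
    have hj := j.2
    have h1 := (hd i j _).1 le_rfl
    exact lt_of_le_of_lt (h1.2 ⟨min i.1 j.1, by omega⟩ (by dsimp only; omega)) (hε _)
  · refine hle _ _ _ _ fun e _ h a ha => h a ?_
    rw [Fin.le_def] at hik hlj
    rw [Fin.lt_def] at hkl
    omega
  · refine le_antisymm (((hd _ _ _).1 le_rfl).2 k (Or.inl ⟨le_rfl, by simp⟩))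
      ((hd _ _ _).2 ⟨(hε k).le, fun a ha => ?_⟩)
    have : a = k := by
      apply Fin.ext
      simp only [Fin.val_castSucc, Fin.val_succ] at ha
      omega
    rw [this]

theorem QPath.sameTail_of_consecutive {V : Type u} [Quiver.{v} V] {m : ℕ}
    {p : Fin (m + 1) → QPath V} {d : Fin (m + 1) → Fin (m + 1) → ℕ}
    (hmono : ∀ i j k l, i ≤ k → k < l → l ≤ j → d i j ≤ d k l)
    (htail : ∀ i : Fin m, QPath.SameTail (d i.castSucc i.succ) (p i.castSucc) (p i.succ))
    {i j : Fin (m + 1)} (hij : i < j) : QPath.SameTail (d i j) (p i) (p j) := by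
  induction j using Fin.induction with
  | zero => exact absurd hij (Fin.not_lt_zero i)
  | succ j ih =>
    obtain rfl | hlt := (Fin.le_castSucc_iff.2 hij).eq_or_lt
    · exact htail j
    · exact ((ih hlt).mono (hmono _ _ _ _ le_rfl hlt (Fin.castSucc_le_succ j))).trans
        ((htail j).mono (hmono _ _ _ _ hlt.le (Fin.castSucc_lt_succ) le_rfl))

namespace SplitPresentation

variable {K : Type w} [Field K] {V : Type u} [Quiver.{v} V] [Fintype V] {Λ : Type x} [Ring Λ]
  [Algebra K Λ] (π : SplitPresentation K V Λ)

section Consecutive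

variable {m : ℕ} (T : Fin (m + 1) → ModuleCat.{x} Λ) (t : ∀ i, T i)

/-- The map from a free module onto a product of cyclic modules. -/
def cyclicPi : (Fin (m + 1) → Λ) →ₗ[Λ] ∀ i, T i :=
  LinearMap.pi fun i => LinearMap.toSpanSingleton Λ (T i) (t i) ∘ₗ LinearMap.proj i

theorem cyclicPi_apply (f : Fin (m + 1) → Λ) (i : Fin (m + 1)) :
    cyclicPi T t f i = f i • t i := rfl

theorem cyclicPi_single (i : Fin (m + 1)) (a : Λ) :
    cyclicPi T t (Pi.single i a) = Pi.single i (a • t i) := by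
  funext j
  rw [cyclicPi_apply]
  by_cases h : j = i
  · subst h
    rw [Pi.single_eq_same, Pi.single_eq_same]
  · rw [Pi.single_eq_of_ne h, Pi.single_eq_of_ne h, zero_smul]

/-- The elements of `Λ` that cut out the submodules of a trunk. -/
noncomputable def truncPath {ι : Type*} (p : ι → QPath V) : ι → ℕ → Λ :=
  fun i e => π.path ((p i).trunc e)

/-- The relation submodule of a saguaro with the given gluing depths of consecutive trunks. -/
def consecutiveRel (p : Fin (m + 1) → QPath V) (d : Fin (m + 1) → Fin (m + 1) → ℕ) :
    Submodule Λ (∀ i, T i) :=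
  Submodule.span Λ (Set.range fun i : Fin m =>
    (Pi.single i.castSucc
        (π.path ((p i.castSucc).trunc (d i.castSucc i.succ)) • t i.castSucc) -
      Pi.single i.succ (π.path ((p i.succ).trunc (d i.castSucc i.succ)) • t i.succ) :
      ∀ i, T i))

variable {T t} {p : Fin (m + 1) → QPath V} {d : Fin (m + 1) → Fin (m + 1) → ℕ}

/-- The relation telescopes into relations between neighbours, each moved to depth `e` along the
common end of the two masts. -/
theorem cyclicPi_single_sub_mem (hmono : ∀ i j k l, i ≤ k → k < l → l ≤ j → d i j ≤ d k l)
    (htail : ∀ i : Fin m, QPath.SameTail (d i.castSucc i.succ) (p i.castSucc) (p i.succ))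
    {i j : Fin (m + 1)} (hij : i < j) {e : ℕ} (he : e ≤ d i j) :
    cyclicPi T t (Pi.single i (π.truncPath p i e)) -
      cyclicPi T t (Pi.single j (π.truncPath p j e)) ∈ π.consecutiveRel T t p d := by
  have step : ∀ k : Fin m, e ≤ d k.castSucc k.succ →
      cyclicPi T t (Pi.single k.castSucc (π.truncPath p k.castSucc e)) -
        cyclicPi T t (Pi.single k.succ (π.truncPath p k.succ e)) ∈ π.consecutiveRel T t p d := by
    intro k hk
    obtain ⟨r, h1, h2⟩ := π.exists_mul_of_sameTail (htail k) hk
    simp only [truncPath]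
    rw [h1, h2, cyclicPi_single, cyclicPi_single, mul_smul, mul_smul,
      Pi.single_smul k.castSucc r, Pi.single_smul k.succ r, ← smul_sub]
    exact Submodule.smul_mem _ _ (Submodule.subset_span ⟨k, rfl⟩)
  induction j using Fin.induction with
  | zero => exact absurd hij (Fin.not_lt_zero i)
  | succ j ih =>
    obtain rfl | hlt := (Fin.le_castSucc_iff.2 hij).eq_or_lt
    · exact step j he
    · have h1 := ih hlt (he.trans (hmono _ _ _ _ le_rfl hlt (Fin.castSucc_le_succ j)))
      have h2 := step j (he.trans (hmono _ _ _ _ hlt.le (Fin.castSucc_lt_succ) le_rfl))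
      simpa using add_mem h1 h2

/-- The relations for all pairs and depths follow from those for neighbours at full depth, and the
kernel of `cyclicPi` consists of the tuples of annihilating elements. -/
theorem glueRel_eq_comap (hsymm : ∀ i j, d i j = d j i)
    (hmono : ∀ i j k l, i ≤ k → k < l → l ≤ j → d i j ≤ d k l)
    (htail : ∀ i : Fin m, QPath.SameTail (d i.castSucc i.succ) (p i.castSucc) (p i.succ)) :
    glueRel (fun i => LinearMap.ker (LinearMap.toSpanSingleton Λ (T i) (t i))) (π.truncPath p) d =
      (π.consecutiveRel T t p d).comap (cyclicPi T t) := by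
  refine le_antisymm (Glue.glueRel_le (fun i a ha => ?_) (fun i j e he => ?_)) (fun f hf => ?_)
  · rw [Submodule.mem_comap, cyclicPi_single]
    rw [LinearMap.mem_ker, LinearMap.toSpanSingleton_apply] at ha
    rw [ha, Pi.single_zero]
    exact zero_mem _
  · rw [Submodule.mem_comap, map_sub]
    rcases lt_trichotomy i j with h | h | h
    · exact π.cyclicPi_single_sub_mem hmono htail h he
    · subst h
      rw [sub_self]
      exact zero_mem _
    · rw [← neg_sub]
      exact neg_mem (π.cyclicPi_single_sub_mem hmono htail h (hsymm i j ▸ he))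
  · have hle : π.consecutiveRel T t p d ≤ (glueRel (fun i => LinearMap.ker
        (LinearMap.toSpanSingleton Λ (T i) (t i))) (π.truncPath p) d).map (cyclicPi T t) := by
      refine Submodule.span_le.2 ?_
      rintro _ ⟨i, rfl⟩
      refine ⟨_, Glue.single_sub_single_mem (i := i.castSucc) (j := i.succ) le_rfl, ?_⟩
      rw [map_sub, cyclicPi_single, cyclicPi_single]
      rfl
    obtain ⟨f', hf', e⟩ := hle hf
    have : f = f' + ∑ i, Pi.single i ((f - f') i) := by
      rw [Finset.univ_sum_single]
      abel
    rw [this]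
    refine add_mem hf' (Submodule.sum_mem _ fun i _ => Glue.single_mem ?_)
    rw [LinearMap.mem_ker, LinearMap.toSpanSingleton_apply, Pi.sub_apply, sub_smul, sub_eq_zero]
    exact (congrFun e i).symm

theorem nonempty_glue_equiv_quotient (ht : ∀ i, π.IsTrunk (p i) (t i))
    (hsymm : ∀ i j, d i j = d j i)
    (hmono : ∀ i j k l, i ≤ k → k < l → l ≤ j → d i j ≤ d k l)
    (htail : ∀ i : Fin m, QPath.SameTail (d i.castSucc i.succ) (p i.castSucc) (p i.succ)) :
    Nonempty (Glue (fun i => LinearMap.ker (LinearMap.toSpanSingleton Λ (T i) (t i)))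
      (π.truncPath p) d ≃ₗ[Λ] (∀ i, T i) ⧸ π.consecutiveRel T t p d) := by
  have hsurj : Function.Surjective ((π.consecutiveRel T t p d).mkQ ∘ₗ cyclicPi T t) := by
    refine (Submodule.mkQ_surjective _).comp fun f => ?_
    choose r hr using fun i => (ht i).smul_surjective (f i)
    exact ⟨r, funext hr⟩
  refine ⟨(Submodule.quotEquivOfEq _ _ ?_).trans (LinearMap.quotKerEquivOfSurjective _ hsurj)⟩
  rw [π.glueRel_eq_comap hsymm hmono htail, LinearMap.ker_comp, Submodule.ker_mkQ]

end Consecutive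

/-- Numerical data describing a saguaro: the annihilators of the top elements of the trunks, the
masts, and the depths at which the trunks are glued. -/
structure IsSaguaroData {ι : Type*} [PartialOrder ι] [DecidableEq ι] (𝔞 : ι → Submodule Λ Λ)
    (p : ι → QPath V) (d : ι → ι → ℕ) : Prop where
  trunk : ∀ i, (𝔞 i, p i) ∈ π.trunkPairs
  symm : ∀ i j, d i j = d j i
  mono : ∀ i j k l, i ≤ k → k < l → l ≤ j → d i j ≤ d k l
  tail : ∀ i j, i ≠ j → QPath.SameTail (d i j) (p i) (p j)
  lt : ∀ i j, i ≠ j → d i j < (p i).length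
  inj : ∀ i z, Pi.single i z ∈ glueRel 𝔞 (π.truncPath p) d → z ∈ 𝔞 i

theorem truncPath_mem_span {ι : Type*} (p : ι → QPath V) {g : ℕ} {i : ι}
    (hg : g < (p i).length) {e : ℕ} (he : e ≤ g) : π.truncPath p i e ∈ Submodule.span Λ {π.truncPath p i g} :=
  π.path_trunc_mem_span hg.le he

theorem truncPath_trunc {ι : Type*} (p : ι → QPath V) (g : ℕ) (i : ι) (e : ℕ) :
    π.truncPath (fun i => (p i).trunc (g + 1)) i e = π.truncPath p i (e + (g + 1)) := by
  rw [truncPath, truncPath, QPath.trunc_trunc]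

/-- Killing the elements at depth `g` kills those at smaller depths, so only the relations at depths
above `g` matter. In terms of the truncated masts these are shifted by `g + 1`. -/
theorem glueRel_quotient_eq {ι : Type*} [DecidableEq ι] {𝔞 : ι → Submodule Λ Λ}
    {p : ι → QPath V} {d : ι → ι → ℕ} {g : ℕ} (hg : ∀ i j, i ≠ j → g < d i j)
    (hlen : ∀ i, g < (p i).length) :
    glueRel (fun i => 𝔞 i ⊔ Submodule.span Λ {π.truncPath p i g}) (π.truncPath p) d =
      glueRel (fun i => 𝔞 i ⊔ Submodule.span Λ {π.truncPath p i g})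
        (π.truncPath fun i => (p i).trunc (g + 1)) (fun i j => d i j - (g + 1)) := by
  refine le_antisymm (Glue.glueRel_le (fun i a ha => Glue.single_mem ha) (fun i j e he => ?_))
    (Glue.glueRel_le (fun i a ha => Glue.single_mem ha) (fun i j e he => ?_))
  · by_cases heg : e ≤ g
    · exact sub_mem
        (Glue.single_mem (Submodule.mem_sup_right (π.truncPath_mem_span p (hlen i) heg)))
        (Glue.single_mem (Submodule.mem_sup_right (π.truncPath_mem_span p (hlen j) heg)))
    · have hee : e - (g + 1) + (g + 1) = e := by omega
      have := Glue.single_sub_single_mem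
        (𝔞 := fun i => 𝔞 i ⊔ Submodule.span Λ {π.truncPath p i g})
        (y := π.truncPath fun i => (p i).trunc (g + 1)) (d := fun i j => d i j - (g + 1))
        (i := i) (j := j) (e := e - (g + 1)) (by omega)
      rwa [truncPath_trunc, truncPath_trunc, hee] at this
  -- On the diagonal `d i i` may be at most `g`, so the subtraction may be truncated, but the
  -- relation is trivial there.
  · by_cases hij : i = j
    · subst hij
      rw [sub_self]
      exact zero_mem _
    · have := hg i j hij
      rw [π.truncPath_trunc, π.truncPath_trunc]
      exact Glue.single_sub_single_mem (by omega)

theorem ker_toSpanSingleton_mkQ {T : Type*} [AddCommGroup T] [Module Λ T] (t : T) (a : Λ) :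
    LinearMap.ker (LinearMap.toSpanSingleton Λ (T ⧸ Submodule.span Λ {a • t})
      ((Submodule.span Λ {a • t}).mkQ t)) =
    LinearMap.ker (LinearMap.toSpanSingleton Λ T t) ⊔ Submodule.span Λ {a} := by
  ext z
  rw [LinearMap.mem_ker, LinearMap.toSpanSingleton_apply, ← map_smul, Submodule.mkQ_apply,
    Submodule.Quotient.mk_eq_zero, Submodule.mem_span_singleton, Submodule.mem_sup]
  constructor
  · rintro ⟨b, hb⟩
    refine ⟨z - b * a, ?_, b * a, Submodule.mem_span_singleton.2 ⟨b, rfl⟩, sub_add_cancel _ _⟩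
    rw [LinearMap.mem_ker, LinearMap.toSpanSingleton_apply, sub_smul, mul_smul, hb, sub_self]
  · rintro ⟨y, hy, c, hc, rfl⟩
    obtain ⟨b, rfl⟩ := Submodule.mem_span_singleton.1 hc
    rw [LinearMap.mem_ker, LinearMap.toSpanSingleton_apply] at hy
    exact ⟨b, by rw [add_smul, hy, zero_add, smul_eq_mul, mul_smul]⟩

namespace IsSaguaroData

variable {π} {ι : Type*} [PartialOrder ι] [DecidableEq ι] {𝔞 : ι → Submodule Λ Λ}
  {p : ι → QPath V} {d : ι → ι → ℕ}

/-- Depths are recorded for all pairs, not only for neighbours, so that trunks can be left out. -/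
theorem comap (h : π.IsSaguaroData 𝔞 p d) {ι' : Type*} [Fintype ι'] [PartialOrder ι']
    [DecidableEq ι'] (f : ι' ↪o ι) :
    π.IsSaguaroData (fun i => 𝔞 (f i)) (fun i => p (f i)) (fun i j => d (f i) (f j)) where
  trunk i := h.trunk (f i)
  symm i j := h.symm (f i) (f j)
  mono i j k l hik hkl hlj := h.mono _ _ _ _ (f.le_iff_le.2 hik) (f.lt_iff_lt.2 hkl)
    (f.le_iff_le.2 hlj)
  tail i j hij := h.tail _ _ (f.injective.ne hij)
  lt i j hij := h.lt _ _ (f.injective.ne hij)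
  inj i z hz := by
    let E : (ι' → Λ) →ₗ[Λ] (ι → Λ) :=
      Fintype.linearCombination Λ fun i => (Pi.single (f i) 1 : ι → Λ)
    have hE : ∀ i a, E (Pi.single i a) = Pi.single (f i) a := fun i a => by
      rw [Fintype.linearCombination_apply_single, ← Pi.single_smul, smul_eq_mul, mul_one]
    have hle : glueRel (fun i => 𝔞 (f i)) (π.truncPath fun i => p (f i))
        (fun i j => d (f i) (f j)) ≤ (glueRel 𝔞 (π.truncPath p) d).comap E := by
      refine Glue.glueRel_le (fun i a ha => ?_) (fun i j e he => ?_)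
      · rw [Submodule.mem_comap, hE]
        exact Glue.single_mem ha
      · rw [Submodule.mem_comap, map_sub, hE, hE]
        exact Glue.single_sub_single_mem he
    have := hle hz
    rw [Submodule.mem_comap, hE] at this
    exact h.inj _ _ this

/-- The point is `inj`. The gluing identifies the elements at depth `g` of all trunks, so killing
them all amounts to killing the one in trunk `i`, and this affects trunk `i` only by the intended
quotient. -/
theorem quotient (h : π.IsSaguaroData 𝔞 p d) {g : ℕ} (hg : ∀ i j, i ≠ j → g < d i j)
    (hlen : ∀ i, g < (p i).length) :
    π.IsSaguaroData (fun i => 𝔞 i ⊔ Submodule.span Λ {π.truncPath p i g})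
      (fun i => (p i).trunc (g + 1)) (fun i j => d i j - (g + 1)) where
  trunk i := by
    obtain ⟨T, t, ht, e⟩ := h.trunk i
    refine ⟨ModuleCat.of Λ (T ⧸ Submodule.span Λ {π.path ((p i).trunc g) • t}), _,
      ht.quotient (hlen i), ?_⟩
    dsimp only at e
    rw [← e]
    exact ker_toSpanSingleton_mkQ t _
  symm i j := by rw [h.symm]
  mono i j k l hik hkl hlj := Nat.sub_le_sub_right (h.mono i j k l hik hkl hlj) _
  tail i j hij := by
    have h1 := hg i j hij
    have h2 := h.tail i j hij
    rw [← Nat.sub_add_cancel h1] at h2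
    exact h2.trunc
  lt i j hij := by
    have h1 := hg i j hij
    have h2 := h.lt i j hij
    rw [QPath.length_trunc (hlen i)]
    omega
  inj i z hz := by
    rw [← π.glueRel_quotient_eq hg hlen] at hz
    have hle : glueRel (fun i => 𝔞 i ⊔ Submodule.span Λ {π.truncPath p i g}) (π.truncPath p) d ≤
        glueRel 𝔞 (π.truncPath p) d ⊔
          Submodule.span Λ {Pi.single i (π.truncPath p i g)} := by
      refine Glue.glueRel_le (fun j a ha => ?_) (fun j l e he =>
        Submodule.mem_sup_left (Glue.single_sub_single_mem he))
      obtain ⟨b, hb, c, hc, rfl⟩ := Submodule.mem_sup.1 ha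
      obtain ⟨s, rfl⟩ := Submodule.mem_span_singleton.1 hc
      rw [Pi.single_add]
      refine add_mem (Submodule.mem_sup_left (Glue.single_mem hb)) ?_
      rw [Pi.single_smul]
      refine Submodule.smul_mem _ _ ?_
      by_cases hij : j = i
      · subst hij
        exact Submodule.mem_sup_right (Submodule.mem_span_singleton_self _)
      · have := add_mem (Submodule.mem_sup_left (T := Submodule.span Λ
            {Pi.single i (π.truncPath p i g)})
          (Glue.single_sub_single_mem (𝔞 := 𝔞) (y := π.truncPath p) (hg j i hij).le))
          (Submodule.mem_sup_right (Submodule.mem_span_singleton_self _))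
        rwa [sub_add_cancel] at this
    obtain ⟨f, hf, f', hf', e⟩ := Submodule.mem_sup.1 (hle hz)
    obtain ⟨s, rfl⟩ := Submodule.mem_span_singleton.1 hf'
    have hf1 : f = Pi.single i (z - s * π.truncPath p i g) := by
      rw [← Pi.single_smul, smul_eq_mul] at e
      rw [Pi.single_sub, ← e, add_sub_cancel_right]
    rw [hf1] at hf
    have := h.inj i _ hf
    rw [← sub_add_cancel z (s * π.truncPath p i g)]
    exact add_mem (Submodule.mem_sup_left this)
      (Submodule.mem_sup_right (Submodule.mem_span_singleton.2 ⟨s, rfl⟩))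

end IsSaguaroData

end SplitPresentation

/-! ### Passing between saguaros and their data -/

namespace SplitPresentation

variable {K : Type w} [Field K] {V : Type u} [Quiver.{v} V] [Fintype V] {Λ : Type x} [Ring Λ]
  [Algebra K Λ] {π : SplitPresentation K V Λ}

theorem IsSaguaroOn.of_equiv {m : ℕ} {T : Fin (m + 1) → ModuleCat.{x} Λ} {M M' : ModuleCat.{x} Λ}
    (h : π.IsSaguaroOn T M) (e : M' ≃ₗ[Λ] M) : π.IsSaguaroOn T M' := by
  obtain ⟨p, t, q, q', U, h1, h2, h3, h4, h5, h6, ⟨f⟩⟩ := h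
  exact ⟨p, t, q, q', U, h1, h2, h3, h4, h5, h6, ⟨e.trans f⟩⟩

theorem single_mem_radical {m : ℕ} {T : Fin (m + 1) → ModuleCat.{x} Λ} {i : Fin (m + 1)}
    {y : T i} (hy : y ∈ radicalSubmodule Λ (T i)) :
    (Pi.single i y : ∀ i, T i) ∈
      Submodule.pi Set.univ (fun i => radicalSubmodule Λ (T i)) := by
  rw [Submodule.mem_pi]
  intro j _
  by_cases hij : j = i
  · subst hij
    rwa [Pi.single_eq_same]
  · rw [Pi.single_eq_of_ne hij]
    exact zero_mem _

theorem IsSaguaroData.exists_isSaguaroOn_fin {m : ℕ} {𝔞 : Fin (m + 1) → Submodule Λ Λ}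
    {p : Fin (m + 1) → QPath V} {d : Fin (m + 1) → Fin (m + 1) → ℕ}
    (h : π.IsSaguaroData 𝔞 p d) : ∃ T : Fin (m + 1) → ModuleCat.{x} Λ,
      π.IsSaguaroOn T (ModuleCat.of Λ (Glue 𝔞 (π.truncPath p) d)) := by
  choose T t ht e using h.trunk
  obtain rfl : 𝔞 = fun i => LinearMap.ker (LinearMap.toSpanSingleton Λ (T i) (t i)) :=
    funext fun i => (e i).symm
  have hne : ∀ i : Fin m, i.castSucc ≠ i.succ := fun i => (Fin.castSucc_lt_succ).ne
  have hlt : ∀ i : Fin m, d i.castSucc i.succ < (p i.castSucc).length := fun i => h.lt _ _ (hne i)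
  have hlt' : ∀ i : Fin m, d i.castSucc i.succ < (p i.succ).length := fun i => by
    rw [h.symm]
    exact h.lt _ _ (hne i).symm
  have htail := fun i : Fin m => h.tail _ _ (hne i)
  have hrad : ∀ (i : Fin (m + 1)) (g : ℕ), g < (p i).length →
      π.path ((p i).trunc g) • t i ∈ radicalSubmodule Λ (T i) := fun i g hg =>
    π.smul_mem_radicalSubmodule (π.path_mem_pathFiltration (by
      rw [QPath.length_trunc hg.le]; omega)) _
  refine ⟨T, p, t, fun i => (p i.castSucc).trunc (d i.castSucc i.succ),
    fun i => (p i.succ).trunc (d i.castSucc i.succ), π.consecutiveRel T t p d,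
    fun i => ⟨(ht i).uniserial, (ht i).mast, (ht i).top⟩,
    fun i => ⟨QPath.isRightSubpath_trunc (hlt i).le, (ht _).trunc_smul_ne_zero (hlt i).le⟩,
    fun i => ⟨QPath.isRightSubpath_trunc (hlt' i).le, (ht _).trunc_smul_ne_zero (hlt' i).le⟩,
    rfl, ?_, fun j => ?_, π.nonempty_glue_equiv_quotient ht h.symm h.mono htail⟩
  · refine Submodule.span_le.2 ?_
    rintro _ ⟨i, rfl⟩
    exact sub_mem (single_mem_radical (hrad _ _ (hlt i))) (single_mem_radical (hrad _ _ (hlt' i)))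
  · rw [← LinearMap.ker_eq_bot, LinearMap.ker_eq_bot']
    intro y hy
    obtain ⟨z, rfl⟩ := (ht j).smul_surjective y
    have h1 : cyclicPi T t (Pi.single j z) ∈ π.consecutiveRel T t p d := by
      rw [cyclicPi_single]
      exact (Submodule.Quotient.mk_eq_zero _).1 hy
    rw [← Submodule.mem_comap, ← π.glueRel_eq_comap h.symm h.mono htail] at h1
    exact h.inj j z h1

theorem IsSaguaroData.exists_isSaguaroOn {ι : Type} [Fintype ι] [LinearOrder ι]
    {𝔞 : ι → Submodule Λ Λ} {p : ι → QPath V} {d : ι → ι → ℕ} (h : π.IsSaguaroData 𝔞 p d) {m : ℕ}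
    (hm : Fintype.card ι = m + 1) : ∃ T : Fin (m + 1) → ModuleCat.{x} Λ,
      π.IsSaguaroOn T (ModuleCat.of Λ (Glue 𝔞 (π.truncPath p) d)) := by
  let f : Fin (m + 1) ≃o ι := Fintype.orderIsoFinOfCardEq ι hm
  obtain ⟨T, hT⟩ := (h.comap f.toOrderEmbedding).exists_isSaguaroOn_fin
  obtain ⟨e⟩ := Glue.nonempty_equiv_reindex (𝔞 := 𝔞) (y := π.truncPath p) (d := d) f.toEquiv
  exact ⟨T, hT.of_equiv e⟩

/-- Let `s` continue `q` to `p`. Since `s q t = p t` is nonzero, so is `s q' t'`. Hence `s` also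
continues `q'`, and the result is no longer than `p'`. -/
theorem IsTrunk.exists_common_continuation {p p' : QPath V} {T T' : Type x} [AddCommGroup T]
    [Module Λ T] [AddCommGroup T'] [Module Λ T'] {t : T} {t' : T'} (h : π.IsTrunk p t)
    (h' : π.IsTrunk p' t') {q q' : QPath V} (hq : QPath.IsRightSubpath q p)
    (hann : ∀ z : Λ, z • π.path q' • t' = 0 → z • π.path q • t = 0) :
    ∃ (a a' b c : V) (y : Quiver.Path a b) (y' : Quiver.Path a' b) (s : Quiver.Path b c),
      p = ⟨a, c, y.comp s⟩ ∧ q = ⟨a, b, y⟩ ∧ q' = ⟨a', b, y'⟩ ∧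
      π.path ⟨a', c, y'.comp s⟩ • t' ≠ 0 ∧ s.length + q'.length ≤ p'.length := by
  obtain ⟨a, b, c, y, s, rfl, rfl⟩ := hq
  have hs : (π.path ⟨b, c, s⟩ * π.path q') • t' ≠ 0 := by
    rw [mul_smul]
    intro h0
    apply h.smul_ne_zero
    rw [← path_mul_path, mul_smul]
    exact hann _ h0
  by_cases hb : q'.tgt = b
  · subst hb
    obtain ⟨a', b, y'⟩ := q'
    rw [path_mul_path] at hs
    refine ⟨a, a', b, c, y, y', s, rfl, rfl, rfl, hs, ?_⟩
    by_contra hlt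
    refine hs (h'.smul_eq_zero_of_length_lt ?_ _)
    simp only [QPath.length, Quiver.Path.length_comp] at hlt ⊢
    omega
  · rw [π.path_mul_path_of_ne hb, zero_smul] at hs
    exact absurd rfl hs

/-- If two trunks contain elements with the same annihilator, each the product of a right
subpath of the mast and the top element, then the masts continue these subpaths in the same way. -/
theorem HasUniqueMasts.sameTail (hu : π.HasUniqueMasts) {p p' : QPath V} {T T' : ModuleCat.{x} Λ}
    {t : T} {t' : T'} (h : π.IsTrunk p t) (h' : π.IsTrunk p' t') {q q' : QPath V}
    (hq : QPath.IsRightSubpath q p) (hq' : QPath.IsRightSubpath q' p')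
    (hann : ∀ z : Λ, z • π.path q • t = 0 ↔ z • π.path q' • t' = 0) :
    QPath.SameTail (p.length - q.length) p p' ∧ q' = p'.trunc (p.length - q.length) := by
  obtain ⟨a₁, a₁', b₁, c₁, y₁, y₁', s₁, rfl, rfl, rfl, -, hle⟩ :=
    h'.exists_common_continuation h hq' (fun z => (hann z).1)
  obtain ⟨a, a', b, c, y, y', s, rfl, hqe, hqe', hs, hle'⟩ :=
    h.exists_common_continuation h' hq (fun z => (hann z).2)
  injection hqe with h1 h2 h3
  subst h1 h2
  injection hqe' with h4 h5 h6
  subst h4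
  obtain rfl := eq_of_heq h3
  obtain rfl := eq_of_heq h6
  -- Each continuation fits after the other subpath within the other mast, so neither is longer.
  -- Then `y₁'.comp s` has the length of a mast and does not kill the top element, so it is the
  -- mast.
  have hls : s.length = s₁.length := by
    simp only [QPath.length, Quiver.Path.length_comp] at hle hle'
    omega
  have hp := hu _ _ _ h' _ (by simp only [QPath.length, Quiver.Path.length_comp, hls]) hs
  have hl : (⟨a₁', c, y₁'.comp s⟩ : QPath V).length - (⟨a₁', b₁, y₁'⟩ : QPath V).length =
      s.length := by
    simp [QPath.length]
  rw [hl]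
  refine ⟨⟨a₁', a₁, b₁, c, y₁', y₁, s, rfl, rfl, hp.symm⟩, ?_⟩
  rw [← hp, QPath.trunc_comp]

theorem IsSaguaroOn.exists_data (hu : π.HasUniqueMasts) {N : ℕ}
    (hN : ∀ (p : QPath V) (T : ModuleCat.{x} Λ) (t : T), π.IsTrunk p t → p.length < N) {m : ℕ}
    {T : Fin (m + 1) → ModuleCat.{x} Λ} {M : ModuleCat.{x} Λ} (h : π.IsSaguaroOn T M) :
    ∃ (𝔞 : Fin (m + 1) → Submodule Λ Λ) (p : Fin (m + 1) → QPath V)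
      (d : Fin (m + 1) → Fin (m + 1) → ℕ), π.IsSaguaroData 𝔞 p d ∧
      (∀ i j l, min (d i j) (d j l) ≤ d i l) ∧ (∀ i, d i i = N) ∧ (∀ i j, i ≠ j → d i j < N) ∧
      Nonempty (M ≃ₗ[Λ] Glue 𝔞 (π.truncPath p) d) := by
  obtain ⟨p, t, q, q', U, h1, h2, h3, hU, hrad, hinj, ⟨f⟩⟩ := h
  have ht : ∀ i, π.IsTrunk (p i) (t i) := fun i => ⟨(h1 i).1, (h1 i).2.1, (h1 i).2.2⟩
  have hinj' : ∀ j (y : T j), (Pi.single j y : ∀ i, T i) ∈ U → y = 0 := by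
    intro j y hy
    apply hinj j
    rw [map_zero]
    exact (Submodule.Quotient.mk_eq_zero U).2 hy
  have hgen : ∀ i : Fin m, (Pi.single i.castSucc (π.path (q i) • t i.castSucc) -
      Pi.single i.succ (π.path (q' i) • t i.succ) : ∀ i, T i) ∈ U := fun i => by
    rw [hU]
    exact Submodule.subset_span ⟨i, rfl⟩
  -- If `z` kills one half of a relation, the multiple by `z` of the other half lies in `U`, and it
  -- vanishes because its trunk embeds.
  have hann : ∀ (i : Fin m) (z : Λ),
      z • π.path (q i) • t i.castSucc = 0 ↔ z • π.path (q' i) • t i.succ = 0 := by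
    intro i z
    have hz := Submodule.smul_mem U z (hgen i)
    rw [smul_sub, ← Pi.single_smul i.castSucc z, ← Pi.single_smul i.succ z] at hz
    refine ⟨fun h0 => hinj' _ _ ?_, fun h0 => hinj' _ _ ?_⟩
    · rw [h0, Pi.single_zero, zero_sub] at hz
      exact neg_mem_iff.1 hz
    · rwa [h0, Pi.single_zero, sub_zero] at hz
  let ε : Fin m → ℕ := fun i => (p i.castSucc).length - (q i).length
  have hst := fun i : Fin m => hu.sameTail (ht i.castSucc) (ht i.succ) (h2 i).1 (h3 i).1 (hann i)
  have hεN : ∀ i, ε i < N := fun i => lt_of_le_of_lt (Nat.sub_le _ _) (hN _ _ _ (ht i.castSucc))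
  obtain ⟨d, hsymm, hultra, hdiag, hlt, hmono, hd⟩ := exists_gluing_depths N ε hεN
  have htail : ∀ i : Fin m, QPath.SameTail (d i.castSucc i.succ) (p i.castSucc) (p i.succ) := by
    intro i
    rw [hd]
    exact (hst i).1
  have hq : ∀ i : Fin m, q i = (p i.castSucc).trunc (d i.castSucc i.succ) := fun i => by
    rw [hd]
    exact (h2 i).1.eq_trunc
  have hq' : ∀ i : Fin m, q' i = (p i.succ).trunc (d i.castSucc i.succ) := fun i => by
    rw [hd]
    exact (hst i).2
  have hUc : U = π.consecutiveRel T t p d := by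
    rw [hU, consecutiveRel]
    congr 2
    funext i
    rw [hq, hq']
  have htop : ∀ i, t i ∉ radicalSubmodule Λ (T i) := fun i => (ht i).isTopElementOfType.1
  have hne : ∀ i : Fin m, i.castSucc ≠ i.succ := fun i => (Fin.castSucc_lt_succ).ne
  have hcomp := fun (i : Fin m) (j : Fin (m + 1)) =>
    Submodule.mem_pi.1 (hrad (hgen i)) j (Set.mem_univ j)
  -- Gluing at the full length of a mast would involve the top element itself, but `U` lies in the
  -- radical.
  have hnontriv : ∀ (i : Fin (m + 1)) (e : ℕ), e ≤ (p i).length →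
      π.path ((p i).trunc e) • t i ∈ radicalSubmodule Λ (T i) → e < (p i).length := by
    intro i e he hmem
    refine lt_of_le_of_ne he fun heq => htop i ?_
    have h0 : (p i).trunc e = QPath.triv (p i).src := by
      refine (QPath.isRightSubpath_trunc he).eq_of_length_eq (p i).isRightSubpath_triv_src ?_
      rw [QPath.length_trunc he, heq]
      simp
    rwa [h0, (ht i).triv_smul] at hmem
  have hltl : ∀ i : Fin m, d i.castSucc i.succ < (p i.castSucc).length := by
    intro i
    refine hnontriv _ _ (htail i).le_length ?_
    have := hcomp i i.castSucc
    rwa [Pi.sub_apply, Pi.single_eq_same, Pi.single_eq_of_ne (hne i), sub_zero, hq] at this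
  have hltr : ∀ i : Fin m, d i.castSucc i.succ < (p i.succ).length := by
    intro i
    refine hnontriv _ _ (htail i).symm.le_length ?_
    have := hcomp i i.succ
    rw [Pi.sub_apply, Pi.single_eq_same, Pi.single_eq_of_ne (hne i).symm, zero_sub, hq'] at this
    exact neg_mem_iff.1 this
  have hltij : ∀ i j, i < j → d i j < (p i).length ∧ d i j < (p j).length := by
    intro i j hij
    constructor
    · obtain ⟨k, rfl⟩ := Fin.exists_castSucc_eq.2 (ne_of_lt (lt_of_lt_of_le hij (Fin.le_last j)))
      exact lt_of_le_of_lt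
        (hmono _ _ _ _ le_rfl (Fin.castSucc_lt_succ) (Fin.castSucc_lt_iff_succ_le.1 hij)) (hltl k)
    · obtain ⟨k, rfl⟩ := Fin.exists_succ_eq.2 (ne_of_gt (lt_of_le_of_lt (Fin.zero_le i) hij))
      exact lt_of_le_of_lt
        (hmono _ _ _ _ (Fin.le_castSucc_iff.2 hij) (Fin.castSucc_lt_succ) le_rfl) (hltr k)
  refine ⟨fun i => LinearMap.ker (LinearMap.toSpanSingleton Λ (T i) (t i)), p, d,
    ⟨fun i => ⟨T i, t i, ht i, rfl⟩, hsymm, hmono, fun i j hij => ?_, fun i j hij => ?_,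
      fun i z hz => ?_⟩, hultra, hdiag, hlt, ?_⟩
  · obtain hij | hij := lt_or_gt_of_ne hij
    · exact QPath.sameTail_of_consecutive hmono htail hij
    · rw [hsymm]
      exact (QPath.sameTail_of_consecutive hmono htail hij).symm
  · obtain hij | hij := lt_or_gt_of_ne hij
    · exact (hltij i j hij).1
    · rw [hsymm]
      exact (hltij j i hij).2
  · rw [π.glueRel_eq_comap hsymm hmono htail, Submodule.mem_comap, cyclicPi_single, ← hUc] at hz
    exact hinj' i _ hz
  · obtain ⟨e⟩ := π.nonempty_glue_equiv_quotient ht hsymm hmono htail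
    exact ⟨(f.trans (Submodule.quotEquivOfEq _ _ hUc)).trans e.symm⟩

end SplitPresentation

/-! ### Finite direct sums, approximations and projective dimension -/

section FiniteType

variable {Λ : Type x} [Ring Λ]

/-- `M` is a finite direct sum of copies of the modules `A i`. -/
def IsSumOf {κ : Type*} (A : κ → ModuleCat.{x} Λ) (M : ModuleCat.{x} Λ) : Prop :=
  ∃ (k : ℕ) (c : Fin k → κ), Nonempty (M ≃ₗ[Λ] ∀ i, A (c i))

theorem IsSumOf.of_equiv_pi {κ : Type*} {A : κ → ModuleCat.{x} Λ} {M : ModuleCat.{x} Λ}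
    {ι : Type*} [Finite ι] (c : ι → κ) (e : M ≃ₗ[Λ] ∀ i, A (c i)) : IsSumOf A M :=
  ⟨Nat.card ι, fun i => c ((Finite.equivFin ι).symm i),
    ⟨e.trans (LinearEquiv.piCongrLeft' Λ (fun i => A (c i)) (Finite.equivFin ι))⟩⟩

theorem IsSumOf.self {κ : Type*} (A : κ → ModuleCat.{x} Λ) (i : κ) : IsSumOf A (A i) :=
  IsSumOf.of_equiv_pi (ι := Unit) (fun _ => i) (LinearEquiv.funUnique Unit Λ (A i)).symm

theorem IsSumOf.of_equiv {κ : Type*} {A : κ → ModuleCat.{x} Λ} {M M' : ModuleCat.{x} Λ}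
    (h : IsSumOf A M) (e : M' ≃ₗ[Λ] M) : IsSumOf A M' := by
  obtain ⟨k, c, ⟨f⟩⟩ := h
  exact ⟨k, c, ⟨e.trans f⟩⟩

theorem IsSumOf.prod {κ : Type*} {A : κ → ModuleCat.{x} Λ} {M M₁ M₂ : ModuleCat.{x} Λ}
    (h₁ : IsSumOf A M₁) (h₂ : IsSumOf A M₂) (e : M ≃ₗ[Λ] M₁ × M₂) : IsSumOf A M := by
  obtain ⟨k₁, c₁, ⟨f₁⟩⟩ := h₁
  obtain ⟨k₂, c₂, ⟨f₂⟩⟩ := h₂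
  exact IsSumOf.of_equiv_pi (Sum.elim c₁ c₂) ((e.trans (f₁.prodCongr f₂)).trans
    (LinearEquiv.sumPiEquivProdPi Λ (Fin k₁) (Fin k₂)
      (fun i => A (Sum.elim c₁ c₂ i))).symm)

theorem IsSumOf.pi {κ : Type*} {A : κ → ModuleCat.{x} Λ} {M : ModuleCat.{x} Λ} {ι : Type*}
    [Finite ι] {N : ι → ModuleCat.{x} Λ} (h : ∀ i, IsSumOf A (N i)) (e : M ≃ₗ[Λ] ∀ i, N i) :
    IsSumOf A M := by
  choose k c f using h
  exact IsSumOf.of_equiv_pi (ι := Σ i, Fin (k i)) (fun z => c z.1 z.2)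
    ((e.trans (LinearEquiv.piCongrRight fun i => (f i).some)).trans
      (LinearEquiv.piCurry Λ (fun i (j : Fin (k i)) => A (c i j))).symm)

theorem IsSumOf.finiteDirectSums {κ : Type*} {A : κ → ModuleCat.{x} Λ}
    {P : ObjectProperty (ModuleCat.{x} Λ)} (hA : ∀ i, P (A i)) {M : ModuleCat.{x} Λ}
    (h : IsSumOf A M) : finiteDirectSums P M := by
  obtain ⟨k, c, f⟩ := h
  exact ⟨k, fun i => A (c i), fun i => hA (c i), f⟩

theorem isSumOf_of_finiteDirectSums {κ : Type*} {A : κ → ModuleCat.{x} Λ}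
    {P : ObjectProperty (ModuleCat.{x} Λ)} (hP : ∀ M, P M → IsSumOf A M) {M : ModuleCat.{x} Λ}
    (h : finiteDirectSums P M) : IsSumOf A M := by
  obtain ⟨n, N, hN, ⟨e⟩⟩ := h
  exact IsSumOf.pi (fun i => hP _ (hN i)) e

theorem hasFiniteRepresentationType_of_isSumOf {κ : Type*} [Finite κ] {A : κ → ModuleCat.{x} Λ}
    {P : ObjectProperty (ModuleCat.{x} Λ)} (hA : ∀ i, P (A i)) (hP : ∀ M, P M → IsSumOf A M) :
    HasFiniteRepresentationType (finiteDirectSums P) := by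
  refine ⟨Nat.card κ, fun i => A ((Finite.equivFin κ).symm i),
    fun i => (IsSumOf.self A _).finiteDirectSums hA, fun M hM => ?_⟩
  obtain ⟨k, c, ⟨f⟩⟩ := isSumOf_of_finiteDirectSums hP hM
  refine ⟨k, fun i => Finite.equivFin κ (c i), ⟨f.trans (LinearEquiv.piCongrRight fun i => ?_)⟩⟩
  exact LinearEquiv.cast (M := fun i => A i) (Equiv.symm_apply_apply _ (c i)).symm

/-- Homomorphisms between finitely generated modules over a finite-dimensional algebra factor
through finitely many of them. -/
theorem exists_hom_generators {K : Type w} [Field K] [Algebra K Λ] [Module.Finite K Λ]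
    (A M : Type x) [AddCommGroup A] [Module Λ A] [Module.Finite Λ A] [AddCommGroup M] [Module Λ M]
    [Module.Finite Λ M] : ∃ (s : ℕ) (f : Fin s → A →ₗ[Λ] M), ∀ g : A →ₗ[Λ] M,
      ∃ h : Fin s → A →ₗ[Λ] A, g = ∑ j, f j ∘ₗ h j := by
  let _ : Module K A := Module.compHom A (algebraMap K Λ)
  let _ : Module K M := Module.compHom M (algebraMap K Λ)
  have : IsScalarTower K Λ A := ⟨fun c r y => by
    change (c • r) • y = algebraMap K Λ c • r • y
    rw [Algebra.smul_def, mul_smul]⟩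
  have : IsScalarTower K Λ M := ⟨fun c r y => by
    change (c • r) • y = algebraMap K Λ c • r • y
    rw [Algebra.smul_def, mul_smul]⟩
  have : SMulCommClass Λ K A := IsScalarTower.to_smulCommClass'
  have : SMulCommClass Λ K M := IsScalarTower.to_smulCommClass'
  have : Module.Finite K A := Module.Finite.trans Λ A
  have : Module.Finite K M := Module.Finite.trans Λ M
  have : Module.Finite K (A →ₗ[Λ] M) :=
    Module.Finite.of_injective (LinearMap.restrictScalarsₗ K Λ A M K)
      (LinearMap.restrictScalars_injective K)
  obtain ⟨s, f, hf⟩ := Module.Finite.exists_fin (R := K) (M := A →ₗ[Λ] M)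
  refine ⟨s, f, fun g => ?_⟩
  obtain ⟨c, hc⟩ := (Submodule.mem_span_range_iff_exists_fun K).1
    (hf ▸ Submodule.mem_top : g ∈ Submodule.span K (Set.range f))
  -- The `f j` span the space of homomorphisms over `K`, so scalar endomorphisms suffice.
  refine ⟨fun j => c j • LinearMap.id, ?_⟩
  rw [← hc]
  refine Finset.sum_congr rfl fun j _ => LinearMap.ext fun a => ?_
  change algebraMap K Λ (c j) • f j a = f j (algebraMap K Λ (c j) • a)
  rw [map_smul]

/-- The approximation has one copy of `A i` for each member of a finite generating family of
homomorphisms from `A i` to `M`. Homomorphisms from direct sums are lifted summand by summand. -/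
theorem isContravariantlyFinite_of_isSumOf (K : Type w) [Field K] [Algebra K Λ]
    [Module.Finite K Λ] {κ : Type*} [Finite κ] {A : κ → ModuleCat.{x} Λ}
    {P : ObjectProperty (ModuleCat.{x} Λ)} (hA : ∀ i, P (A i))
    (hfin : ∀ i, Module.Finite Λ (A i)) (hP : ∀ M, P M → IsSumOf A M) :
    IsContravariantlyFinite (finiteDirectSums P) := by
  classical
  refine ⟨fun X hX => ?_, fun M hM => ?_⟩
  · obtain ⟨k, c, ⟨f⟩⟩ := isSumOf_of_finiteDirectSums hP hX
    exact Module.Finite.equiv f.symm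
  have := Fintype.ofFinite κ
  choose s f hf using fun i => exists_hom_generators (Λ := Λ) (K := K) (A i) M
  let X : ModuleCat.{x} Λ := ModuleCat.of Λ (∀ l : Fin (Nat.card (Σ i : κ, Fin (s i))),
    A ((Finite.equivFin (Σ i : κ, Fin (s i))).symm l).1)
  let e : X ≃ₗ[Λ] (∀ z : (Σ i : κ, Fin (s i)), A z.1) :=
    (LinearEquiv.piCongrLeft' Λ (fun z : (Σ i : κ, Fin (s i)) => A z.1)
      (Finite.equivFin (Σ i : κ, Fin (s i)))).symm
  let F : (∀ z : (Σ i : κ, Fin (s i)), A z.1) →ₗ[Λ] M :=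
    ∑ z : (Σ i : κ, Fin (s i)), f z.1 z.2 ∘ₗ LinearMap.proj z
  have hF : ∀ (i : κ) (g : A i →ₗ[Λ] M),
      ∃ η : A i →ₗ[Λ] (∀ z : (Σ i : κ, Fin (s i)), A z.1), F ∘ₗ η = g := by
    intro i g
    obtain ⟨h, hh⟩ := hf i g
    have hs : ∀ j : Fin (s i), F ∘ₗ LinearMap.single Λ
        (fun z : (Σ i : κ, Fin (s i)) => A z.1) ⟨i, j⟩ = f i j := by
      intro j
      refine LinearMap.ext fun a => ?_
      simp only [F, LinearMap.comp_apply, LinearMap.sum_apply, LinearMap.proj_apply,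
        LinearMap.single_apply]
      rw [Finset.sum_eq_single ⟨i, j⟩]
      · rw [Pi.single_eq_same]
      · intro z _ hz
        rw [Pi.single_eq_of_ne hz, map_zero]
      · simp
    refine ⟨∑ j, LinearMap.single Λ (fun z : (Σ i : κ, Fin (s i)) => A z.1) ⟨i, j⟩ ∘ₗ h j, ?_⟩
    clear_value F
    refine LinearMap.ext fun a => ?_
    rw [hh, LinearMap.comp_apply, LinearMap.sum_apply, LinearMap.sum_apply, map_sum]
    exact Finset.sum_congr rfl fun j _ => LinearMap.congr_fun (hs j) (h j a)
  refine ⟨X, ModuleCat.ofHom (F ∘ₗ e.toLinearMap), ?_, fun Y hY g => ?_⟩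
  · exact ⟨_, fun l => A ((Finite.equivFin (Σ i : κ, Fin (s i))).symm l).1, fun l => hA _,
      ⟨LinearEquiv.refl Λ _⟩⟩
  · obtain ⟨k, c, ⟨φ⟩⟩ := isSumOf_of_finiteDirectSums hP hY
    choose η hη using fun l : Fin k => hF (c l)
      (g.hom ∘ₗ φ.symm.toLinearMap ∘ₗ LinearMap.single Λ (fun l => A (c l)) l)
    refine ⟨ModuleCat.ofHom (e.symm.toLinearMap ∘ₗ
      (∑ l, η l ∘ₗ LinearMap.proj l) ∘ₗ φ.toLinearMap), ModuleCat.hom_ext ?_⟩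
    refine LinearMap.ext fun y => ?_
    simp only [ModuleCat.hom_comp, ModuleCat.hom_ofHom, LinearMap.comp_apply,
      LinearEquiv.coe_coe, LinearEquiv.apply_symm_apply, LinearMap.sum_apply, map_sum,
      LinearMap.proj_apply]
    have h1 : ∀ l : Fin k, F (η l (φ y l)) =
        g.hom (φ.symm (Pi.single l (φ y l))) := fun l => by
      have := LinearMap.congr_fun (hη l) (φ y l)
      simpa using this
    simp only [h1]
    rw [← map_sum, ← map_sum, Finset.univ_sum_single, LinearEquiv.symm_apply_apply]

theorem hasFiniteProjectiveDimension_of_equiv_pi {M : ModuleCat.{x} Λ}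
    (hM : HasFiniteProjectiveDimension M) {ι : Type*} {N : ι → ModuleCat.{x} Λ}
    (e : M ≃ₗ[Λ] ∀ i, N i) (i : ι) : HasFiniteProjectiveDimension (N i) := by
  classical
  obtain ⟨n, hn⟩ := hM
  refine ⟨n, Retract.hasProjectiveDimensionLT (Y := M)
    ⟨ModuleCat.ofHom (e.symm.toLinearMap ∘ₗ LinearMap.single Λ (fun i => N i) i),
      ModuleCat.ofHom (LinearMap.proj i ∘ₗ e.toLinearMap), ModuleCat.hom_ext ?_⟩ n⟩
  refine LinearMap.ext fun y => ?_
  simp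

end FiniteType

/-! ### Reduction to boundedly many trunks -/

namespace SplitPresentation

variable {K : Type w} [Field K] {V : Type u} [Quiver.{v} V] [Fintype V] {Λ : Type x} [Ring Λ]
  [Algebra K Λ] {π : SplitPresentation K V Λ}

theorem moduleFinite (π : SplitPresentation K V Λ) [∀ a b : V, Finite (a ⟶ b)] :
    Module.Finite K Λ := by
  obtain ⟨N, hN⟩ := π.exists_pow_le
  refine ⟨Submodule.fg_def.2 ⟨π.path '' {p | p.length < N},
    (QPath.finite_length_lt N).image _, ?_⟩⟩
  rw [eq_top_iff]
  intro y _
  refine (Submodule.span_le.2 ?_ : π.pathFiltration 0 ≤ _) (π.mem_pathFiltration_zero y)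
  rintro _ ⟨p, -, rfl⟩
  by_cases hp : p.length < N
  · exact Submodule.subset_span ⟨p, hp, rfl⟩
  · rw [path, hN p (not_lt.1 hp)]
    exact zero_mem _

theorem IsSaguaro.moduleFinite {M : ModuleCat.{x} Λ} (h : π.IsSaguaro M) : Module.Finite Λ M := by
  obtain ⟨m, T, p, t, q, q', U, h1, -, -, -, -, -, ⟨e⟩⟩ := h
  have : ∀ i, Module.Finite Λ (T i) := fun i => by
    obtain ⟨_, _⟩ := isFiniteLength_iff_isNoetherian_isArtinian.1 (h1 i).1.1
    infer_instance
  exact Module.Finite.equiv e.symm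

/-- A saguaro whose index set has a suitable retraction is a direct sum of two saguaros with
fewer trunks. -/
theorem IsSaguaroData.exists_splitting {m : ℕ} {𝔞 : Fin (m + 1) → Submodule Λ Λ}
    {p : Fin (m + 1) → QPath V} {d : Fin (m + 1) → Fin (m + 1) → ℕ} (h : π.IsSaguaroData 𝔞 p d)
    (r : Fin (m + 1) → Fin (m + 1)) (g : ℕ) (hr : ∀ i, r (r i) = r i)
    (h𝔞 : ∀ i, 𝔞 (r i) = 𝔞 i) (hp : ∀ i, p (r i) = p i)
    (hd : ∀ i j, r i = r j ∨ d i j ≤ d (r i) (r j)) (hout : ∀ i j, r i ≠ i → r j = j → d i j ≤ g)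
    (hin : ∀ i, r i ≠ i → g ≤ d i (r i)) (hg : ∀ i j, r i ≠ i → r j ≠ j → g < d i j)
    (hmoved : ∃ i, r i ≠ i) :
    ∃ (M₁ M₂ : ModuleCat.{x} Λ) (m₁ m₂ : ℕ) (T₁ : Fin (m₁ + 1) → ModuleCat.{x} Λ)
      (T₂ : Fin (m₂ + 1) → ModuleCat.{x} Λ), m₁ < m ∧ m₂ < m ∧ π.IsSaguaroOn T₁ M₁ ∧
      π.IsSaguaroOn T₂ M₂ ∧ Nonempty (Glue 𝔞 (π.truncPath p) d ≃ₗ[Λ] M₁ × M₂) := by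
  obtain ⟨i₀, hi₀⟩ := hmoved
  -- The distinct trunks `i` and `r i` are glued at depth at least `g` and strictly below the top,
  -- so the quotient trunk is nonzero.
  have hlen : ∀ i, r i ≠ i → g < (p i).length := fun i hi =>
    lt_of_le_of_lt (hin i hi) (h.lt i (r i) hi.symm)
  have hcard := Fintype.card_subtype_compl (fun i => r i = i)
  have hpos₁ : 0 < Fintype.card {i // r i = i} := Fintype.card_pos_iff.2 ⟨⟨r i₀, hr i₀⟩⟩
  have hpos₂ : 0 < Fintype.card {i // ¬ r i = i} := Fintype.card_pos_iff.2 ⟨⟨i₀, hi₀⟩⟩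
  rw [Fintype.card_fin] at hcard
  have d₁ : π.IsSaguaroData (fun i : {i // r i = i} => 𝔞 i) (fun i => p i) (fun i j => d i j) :=
    h.comap (OrderEmbedding.subtype fun i => r i = i)
  have d₂ : π.IsSaguaroData (fun i : {i // r i ≠ i} => 𝔞 i) (fun i => p i) (fun i j => d i j) :=
    h.comap (OrderEmbedding.subtype fun i => r i ≠ i)
  have hg' : ∀ i j : {i // r i ≠ i}, i ≠ j → g < d i j := fun i j _ => hg i j i.2 j.2
  have d₃ := d₂.quotient hg' (fun i => hlen i i.2)
  have hrel := π.glueRel_quotient_eq (𝔞 := fun i : {i // r i ≠ i} => 𝔞 i) hg'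
    (fun i => hlen i i.2)
  obtain ⟨T₁, hT₁⟩ := d₁.exists_isSaguaroOn (m := Fintype.card {i // r i = i} - 1) (by omega)
  obtain ⟨T₂, hT₂⟩ := d₃.exists_isSaguaroOn (m := Fintype.card {i // ¬ r i = i} - 1)
    (by change Fintype.card {i // ¬ r i = i} = _; omega)
  obtain ⟨e⟩ := Glue.nonempty_equiv_prod (𝔞 := 𝔞) (y := π.truncPath p) (d := d) r g hr h𝔞
    (fun i => by funext a; rw [truncPath, truncPath, hp]) hd
    (fun i j hi hj => ⟨hout i j hi hj, h.symm i j ▸ hout i j hi hj⟩) hin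
    (fun i hi e he => π.truncPath_mem_span p (hlen i hi) he)
  exact ⟨_, _, _, _, T₁, T₂, by omega, by omega, hT₁, hT₂,
    ⟨e.trans ((LinearEquiv.refl Λ _).prodCongr (Submodule.quotEquivOfEq _ _ hrel))⟩⟩

/-- Finitely many saguaros suffice to build all of them as direct sums. -/
theorem exists_finite_isSumOf (hu : π.HasUniqueMasts) (hfin : π.trunkPairs.Finite) :
    ∃ (n : ℕ) (A : Fin n → ModuleCat.{x} Λ), (∀ i, π.IsSaguaro (A i)) ∧
      ∀ M, π.IsSaguaro M → IsSumOf A M := by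
  classical
  obtain ⟨N, hN⟩ := π.exists_length_lt_of_isTrunk
  have := hfin.to_subtype
  obtain ⟨L, hL⟩ := exists_retraction_of_card_ball N π.trunkPairs N le_rfl
  let D := Σ n : Fin (L + 1), (Fin n → π.trunkPairs) × (Fin n → Fin n → Fin (N + 1))
  let rep : D → ModuleCat.{x} Λ := fun z => ModuleCat.of Λ
    (Glue (fun i => (z.2.1 i).1.1) (π.truncPath fun i => (z.2.1 i).1.2)
      (fun i j => (z.2.2 i j : ℕ)))
  -- `D` lists all tables of the right size, so those that give no saguaro have to be discarded.
  let S := {z : D // π.IsSaguaro (rep z)}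
  let A : Fin (Nat.card S) → ModuleCat.{x} Λ := fun i => rep ((Finite.equivFin S).symm i).1
  have hA : ∀ z : D, π.IsSaguaro (rep z) → IsSumOf A (rep z) := by
    intro z hz
    have h1 : A (Finite.equivFin S ⟨z, hz⟩) = rep z := by
      simp only [A, Equiv.symm_apply_apply]
    rw [← h1]
    exact IsSumOf.self A _
  refine ⟨Nat.card S, A, fun i => ((Finite.equivFin S).symm i).2, ?_⟩
  rintro M ⟨m, T, hT⟩
  induction m using Nat.strong_induction_on generalizing M with
  | _ m ih =>
    obtain ⟨𝔞, p, d, hdata, hultra, hdiag, hlt, ⟨e⟩⟩ := hT.exists_data hu hN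
    have hleN : ∀ i j, d i j ≤ N := fun i j => by
      by_cases hij : i = j
      · rw [hij, hdiag]
      · exact (hlt i j hij).le
    by_cases hm : m + 1 ≤ L
    · let z : D := ⟨⟨m + 1, Nat.lt_succ_of_le hm⟩, fun i => ⟨(𝔞 i, p i), hdata.trunk i⟩,
        fun i j => ⟨d i j, Nat.lt_succ_of_le (hleN i j)⟩⟩
      have ez : M ≃ₗ[Λ] rep z := e
      refine (hA z ⟨m, T, hT.of_equiv ez.symm⟩).of_equiv ez
    -- A ball of level `N - N = 0` is the whole set of `m + 1` trunks.
    · obtain ⟨r, g, hr, hc, hd, hout, hin, hg, hmoved⟩ := hL (m + 1)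
        (fun i => ⟨(𝔞 i, p i), hdata.trunk i⟩) d hdata.symm hultra hdiag hlt 0 (by
          simp only [Nat.sub_self, Nat.zero_le, Finset.filter_true, Finset.card_univ,
            Fintype.card_fin]
          omega)
      have hc' : ∀ i, 𝔞 (r i) = 𝔞 i ∧ p (r i) = p i := fun i => by
        have := congrArg Subtype.val (hc i)
        exact ⟨congrArg Prod.fst this, congrArg Prod.snd this⟩
      obtain ⟨M₁, M₂, m₁, m₂, T₁, T₂, hm₁, hm₂, hT₁, hT₂, ⟨f⟩⟩ :=
        hdata.exists_splitting r g hr (fun i => (hc' i).1) (fun i => (hc' i).2) hd hout hin hg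
          hmoved
      exact (ih m₁ hm₁ M₁ T₁ hT₁).prod (ih m₂ hm₂ M₂ T₂ hT₂) (e.trans f)

end SplitPresentation

theorem theorem8p1 {K : Type w} [Field K] {V : Type u} [Quiver.{v} V] [Fintype V]
    [∀ a b : V, Finite (a ⟶ b)] {Λ : Type x} [Ring Λ] [Algebra K Λ]
    (π : SplitPresentation K V Λ)
    (h : (Infinite K ∧ ∀ p : QPath V, (π.uniserialVariety p).Finite) ∨
      π.UniserialGraphsAreEdgePaths) :
    HasFiniteRepresentationType π.saguaroCat ∧
      HasFiniteRepresentationType π.saguaroCatInf ∧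
      IsContravariantlyFinite π.saguaroCat ∧
      IsContravariantlyFinite π.saguaroCatInf := by
  obtain ⟨hu, hfin⟩ := SplitPresentation.hasUniqueMasts_and_finite_trunkPairs h
  obtain ⟨n, A, hA, hsum⟩ := SplitPresentation.exists_finite_isSumOf hu hfin
  have := π.moduleFinite
  -- The same list, restricted to finite projective dimension, serves the second category: every `A
  -- i` that occurs in a module of finite projective dimension is a retract of it.
  let B : {i // HasFiniteProjectiveDimension (A i)} → ModuleCat.{x} Λ := fun i => A i
  have hB : ∀ i, π.IsSaguaro (B i) ∧ HasFiniteProjectiveDimension (B i) :=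
    fun i => ⟨hA i, i.2⟩
  have hsumB : ∀ M, π.IsSaguaro M ∧ HasFiniteProjectiveDimension M → IsSumOf B M := by
    rintro M ⟨hM, hpd⟩
    obtain ⟨k, c, ⟨e⟩⟩ := hsum M hM
    exact ⟨k, fun i => ⟨c i, hasFiniteProjectiveDimension_of_equiv_pi hpd e i⟩, ⟨e⟩⟩
  exact ⟨hasFiniteRepresentationType_of_isSumOf hA hsum,
    hasFiniteRepresentationType_of_isSumOf
      (P := fun M => π.IsSaguaro M ∧ HasFiniteProjectiveDimension M) hB hsumB,
    isContravariantlyFinite_of_isSumOf K hA (fun i => (hA i).moduleFinite) hsum,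
    isContravariantlyFinite_of_isSumOf K
      (P := fun M => π.IsSaguaro M ∧ HasFiniteProjectiveDimension M) hB
      (fun i => (hB i).1.moduleFinite) hsumB⟩
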